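/- Let $d,d_1,d_2\ge 0$ be integers and let $A\in\mathbb{R}^{d\times d}$, $B_1\in\mathbb{R}^{d\times d_1}$, $B_2\in\mathbb{R}^{d\times d_2}$. Let $Q,Q_T\in\mathbb{R}^{d\times d}$, $R_1\in\mathbb{R}^{d_1\times d_1}$, $R_2\in\mathbb{R}^{d_2\times d_2}$ be symmetric positive definite, with $(A,B_1)$ stabilizable and $(A,Q^{1/2})$ detectable, and let $\gamma_1,\gamma_2>0$. Let $\pi=\{t_0<t_1<\dots<t_N=T\}$, $N\ge 1$, be a partition of $[t_0,T]$ and let $x_0\in\mathbb{R}^d$. An admissible mixed strategy $\alpha\in\mathcal{A}_m^\pi$ of Player 1 (the minimizer) is a sequence $\{\mu_k\}_{k=0}^{N-1}$ of measurable maps (probability kernels) $x\mapsto\mu_k(\cdot\mid x)$ from $\mathbb{R}^d$ to the probability measures on $\mathbb{R}^{d_1}$ with $$\int\|u\|^2\,\mu_k(du\mid x)\le\gamma_1^2\|x\|^2\qquad\text{for all }x\in\mathbb{R}^d\text{ and all }k.$$ An admissible mixed strategy $\beta=\{\nu_k\}_{k=0}^{N-1}\in\mathcal{B}_m^\pi$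 of Player 2 (the maximizer) is defined in the same way with $\mathbb{R}^{d_2}$ and $\gamma_2$. A pair $(\alpha,\beta)$ is played as follows. The state solves $\dot x=Ax+B_1u+B_2v$, $x(t_0)=x_0$, where $u(t)=u_k$ and $v(t)=v_k$ for $t\in[t_k,t_{k+1})$. At each $t_k$, given the past, the actions $u_k$ and $v_k$ are drawn independently from $\mu_k(\cdot\mid x(t_k))$ and $\nu_k(\cdot\mid x(t_k))$. The expected cost is $$J(t_0,x_0,\alpha,\beta)=\mathbb{E}\Big[\int_{t_0}^T\big(x^\top Qx+u^\top R_1u-v^\top R_2v\big)\,dt+x(T)^\top Q_Tx(T)\Big],$$ the expectation being taken with respect to the law of $(u_k,v_k)_{0\le k<N}$ induced by $(\alpha,\beta)$ and $x_0$. **Theorem (existence of the game value).** For every $(\alpha,\beta)\in\mathcal{A}_m^\pi\times\mathcal{B}_m^\pi$ the induced law is a probability measure and the realized cost is integrable under it, so that $J(t_0,x_0,\alpha,\beta)$ is well defined and finite. Moreover, the game has a unique (finite) value: there is exactly one real number $V_m^\pi(t_0,x_0)$ with $$\inf_{\alpha\in\mathcal{A}_m^\pi}\ \sup_{\beta\in\mathcal{B}_m^\pi}J(t_0,x_0,\alpha,\beta)=V_m^\pi(t_0,x_0)=\sup_{\beta\in\mathcal{B}_m^\pi}\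 \inf_{\alpha\in\mathcal{A}_m^\pi}J(t_0,x_0,\alpha,\beta).$$ -/

import Mathlib

open MeasureTheory ProbabilityTheory
open scoped Matrix MatrixOrder

/-- The space `ℝⁿ` with its Euclidean norm. -/
abbrev RVec (n : ℕ) : Type := EuclideanSpace ℝ (Fin n)

/-- The linear map `x ↦ M x` between Euclidean spaces. -/
noncomputable abbrev mulE {m n : ℕ} (M : Matrix (Fin m) (Fin n) ℝ) (x : RVec n) : RVec m :=
  WithLp.toLp 2 (M *ᵥ x.ofLp)

/-- The quadratic form `xᵀ M x`. -/
noncomputable def quadForm {n : ℕ} (M : Matrix (Fin n) (Fin n) ℝ) (x : RVec n) : ℝ :=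
  x.ofLp ⬝ᵥ (M *ᵥ x.ofLp)

/-- All (complex) eigenvalues of the real matrix `M` have negative real part. -/
def IsHurwitz {n : ℕ} (M : Matrix (Fin n) (Fin n) ℝ) : Prop :=
  ∀ z ∈ spectrum ℂ (M.map (algebraMap ℝ ℂ)), z.re < 0

/-- `(A, B)` is stabilizable: some feedback `u = K x` makes `A + B K` Hurwitz. -/
def IsStabilizable {n m : ℕ} (A : Matrix (Fin n) (Fin n) ℝ) (B : Matrix (Fin n) (Fin m) ℝ) :
    Prop :=
  ∃ K : Matrix (Fin m) (Fin n) ℝ, IsHurwitz (A + B * K)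

/-- `(A, C)` is detectable: some output injection makes `A + L C` Hurwitz. -/
def IsDetectable {n p : ℕ} (A : Matrix (Fin n) (Fin n) ℝ) (C : Matrix (Fin p) (Fin n) ℝ) :
    Prop :=
  ∃ L : Matrix (Fin n) (Fin p) ℝ, IsHurwitz (A + L * C)

/-- A partition `t₀ = τ 0 < τ 1 < ⋯ < τ N = T` of `[t₀, T]` into `N ≥ 1` sampling intervals. -/
structure SamplingPartition (t₀ T : ℝ) (N : ℕ) where
  /-- the sampling instants -/
  τ : Fin (N + 1) → ℝ
  pos : 0 < N
  strictMono : StrictMono τ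
  first : τ 0 = t₀
  last : τ (Fin.last N) = T

/-- The data of the linear-quadratic game: state in `ℝᵈ`, minimizer's control in `ℝᵈ¹`,
maximizer's control in `ℝᵈ²`, and the actuation capacities `γ₁`, `γ₂`. -/
structure LQGame (d d₁ d₂ : ℕ) where
  A : Matrix (Fin d) (Fin d) ℝ
  B₁ : Matrix (Fin d) (Fin d₁) ℝ
  B₂ : Matrix (Fin d) (Fin d₂) ℝ
  Q : Matrix (Fin d) (Fin d) ℝ
  QT : Matrix (Fin d) (Fin d) ℝ
  R₁ : Matrix (Fin d₁) (Fin d₁) ℝ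
  R₂ : Matrix (Fin d₂) (Fin d₂) ℝ
  γ₁ : ℝ
  γ₂ : ℝ

/-- The assumptions on the system matrices and capacities (`Matrix.PosDef` includes symmetry;
`CFC.sqrt Q` is the positive semidefinite square root of `Q`). -/
structure LQGame.Standing {d d₁ d₂ : ℕ} (G : LQGame d d₁ d₂) : Prop where
  Q_posDef : G.Q.PosDef
  QT_posDef : G.QT.PosDef
  R₁_posDef : G.R₁.PosDef
  R₂_posDef : G.R₂.PosDef
  stabilizable : IsStabilizable G.A G.B₁
  detectable : IsDetectable G.A (CFC.sqrt G.Q)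
  γ₁_pos : 0 < G.γ₁
  γ₂_pos : 0 < G.γ₂

/-- Admissible Markovian mixed strategies with capacity `γ`: for each of the `N` sampling instants
a probability kernel from the observed state to the control, with second moment at most
`γ² ‖x‖²` at the state `x`. The moment is a Lebesgue integral with values in `[0, ∞]`. -/
structure MixedStrategy (d m N : ℕ) (γ : ℝ) where
  /-- the conditional laws of the controls -/
  kernel : Fin N → Kernel (RVec d) (RVec m)
  markov : ∀ k, IsMarkovKernel (kernel k)
  energy : ∀ k x, ∫⁻ w, ‖w‖ₑ ^ 2 ∂(kernel k x) ≤ ENNReal.ofReal (γ ^ 2 * ‖x‖ ^ 2)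

namespace LQGame

variable {d d₁ d₂ N : ℕ} {t₀ T : ℝ}

/-- A realized sequence `((u₀, v₀), …, (u_{N-1}, v_{N-1}))` of control actions. -/
abbrev Actions (d₁ d₂ N : ℕ) : Type := Fin N → RVec d₁ × RVec d₂

/-- The control signals held constant on each interval: the value at time `t` is `ω k` for
`t ∈ [τ k, τ (k+1))`. -/
noncomputable def signal (π : SamplingPartition t₀ T N) (ω : Actions d₁ d₂ N) (t : ℝ) :
    RVec d₁ × RVec d₂ :=
  ∑ k : Fin N, (Set.Ico (π.τ k.castSucc) (π.τ k.succ)).indicator (fun _ => ω k) t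

/-- The state at time `t`, i.e. the solution of `ẋ = A x + B₁ u + B₂ v`, `x(t₀) = x₀`, driven by
the piecewise constant signals (variation of constants). -/
noncomputable def state (G : LQGame d d₁ d₂) (π : SamplingPartition t₀ T N) (x₀ : RVec d)
    (ω : Actions d₁ d₂ N) (t : ℝ) : RVec d :=
  mulE (NormedSpace.exp ((t - t₀) • G.A)) x₀ +
    ∫ s in t₀..t, mulE (NormedSpace.exp ((t - s) • G.A))
      (mulE G.B₁ (signal π ω s).1 + mulE G.B₂ (signal π ω s).2)

/-- The realized cost
`∫_{t₀}^T (xᵀ Q x + uᵀ R₁ u - vᵀ R₂ v) dt + x(T)ᵀ Q_T x(T)` of a sequence of actions. -/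
noncomputable def cost (G : LQGame d d₁ d₂) (π : SamplingPartition t₀ T N) (x₀ : RVec d)
    (ω : Actions d₁ d₂ N) : ℝ :=
  (∫ t in t₀..T, (quadForm G.Q (G.state π x₀ ω t) + quadForm G.R₁ (signal π ω t).1
      - quadForm G.R₂ (signal π ω t).2)) + quadForm G.QT (G.state π x₀ ω T)

theorem measurable_signal (π : SamplingPartition t₀ T N) :
    Measurable fun p : Actions d₁ d₂ N × ℝ => signal π p.1 p.2 := by
  unfold signal
  refine Finset.measurable_sum _ fun k _ => ?_
  have : (fun p : Actions d₁ d₂ N × ℝ =>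
      (Set.Ico (π.τ k.castSucc) (π.τ k.succ)).indicator (fun _ => p.1 k) p.2) =
      (Prod.snd ⁻¹' Set.Ico (π.τ k.castSucc) (π.τ k.succ)).indicator
        (fun p : Actions d₁ d₂ N × ℝ => p.1 k) := by
    ext1 p
    simp [Set.indicator]
  rw [this]
  exact Measurable.indicator (by fun_prop) (measurable_snd measurableSet_Ico)

theorem continuous_mulE {m n : ℕ} :
    Continuous fun p : Matrix (Fin m) (Fin n) ℝ × RVec n => mulE p.1 p.2 := by
  unfold mulE
  fun_prop

theorem continuous_exp_smul (A : Matrix (Fin d) (Fin d) ℝ) (t : ℝ) :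
    Continuous fun s : ℝ => NormedSpace.exp ((t - s) • A) := by
  let _ : NormedRing (Matrix (Fin d) (Fin d) ℝ) := Matrix.linftyOpNormedRing
  let _ : NormedAlgebra ℝ (Matrix (Fin d) (Fin d) ℝ) := Matrix.linftyOpNormedAlgebra
  let _ : NormedAlgebra ℚ (Matrix (Fin d) (Fin d) ℝ) := NormedAlgebra.restrictScalars ℚ ℝ _
  have h : Continuous (NormedSpace.exp : Matrix (Fin d) (Fin d) ℝ → _) :=
    NormedSpace.exp_continuous
  exact h.comp (by fun_prop)

theorem measurable_state (G : LQGame d d₁ d₂) (π : SamplingPartition t₀ T N) (x₀ : RVec d)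
    (t : ℝ) : Measurable fun ω => G.state π x₀ ω t := by
  have hf : StronglyMeasurable fun p : Actions d₁ d₂ N × ℝ =>
      mulE (NormedSpace.exp ((t - p.2) • G.A))
        (mulE G.B₁ (signal π p.1 p.2).1 + mulE G.B₂ (signal π p.1 p.2).2) := by
    have hs := measurable_signal (d₁ := d₁) (d₂ := d₂) π
    have h1 : Measurable fun p : Actions d₁ d₂ N × ℝ =>
        mulE G.B₁ (signal π p.1 p.2).1 + mulE G.B₂ (signal π p.1 p.2).2 := by
      have hB₁ : Continuous (mulE G.B₁) := by unfold mulE; fun_prop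
      have hB₂ : Continuous (mulE G.B₂) := by unfold mulE; fun_prop
      exact (hB₁.measurable.comp hs.fst).add (hB₂.measurable.comp hs.snd)
    have : TopologicalSpace.PseudoMetrizableSpace (Matrix (Fin d) (Fin d) ℝ) :=
      inferInstanceAs (TopologicalSpace.PseudoMetrizableSpace (Fin d → Fin d → ℝ))
    have h2 : StronglyMeasurable fun p : Actions d₁ d₂ N × ℝ =>
        NormedSpace.exp ((t - p.2) • G.A) :=
      ((continuous_exp_smul G.A t).comp continuous_snd).stronglyMeasurable
    exact continuous_mulE.comp_stronglyMeasurable (h2.prodMk h1.stronglyMeasurable)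
  unfold state
  refine measurable_const.add ?_
  simp only [intervalIntegral]
  exact (hf.integral_prod_right (ν := volume.restrict (Set.Ioc t₀ t))).measurable.sub
    (hf.integral_prod_right (ν := volume.restrict (Set.Ioc t t₀))).measurable

/-- Stage `k` of the game: at the sampled state `x(τ k)` the two actions are drawn independently
from `μ k (x(τ k))` and `ν k (x(τ k))` and are written into the `k`-th place of the sequence.
The state `x(τ k)` depends only on the places before `k`. -/
noncomputable def stage (G : LQGame d d₁ d₂) (π : SamplingPartition t₀ T N) (x₀ : RVec d)
    (α : MixedStrategy d d₁ N G.γ₁) (β : MixedStrategy d d₂ N G.γ₂) (k : Fin N) :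
    Kernel (Actions d₁ d₂ N) (Actions d₁ d₂ N) :=
  (Kernel.id ×ₖ ((α.kernel k ×ₖ β.kernel k).comap (fun ω => G.state π x₀ ω (π.τ k.castSucc))
      (G.measurable_state π x₀ _))).map
    (fun p : Actions d₁ d₂ N × (RVec d₁ × RVec d₂) => Function.update p.1 k p.2)

/-- The law of the sequence of actions after the stages before `k` have been played; the places
from `k` on still hold the placeholder `0`. -/
noncomputable def lawUpTo (G : LQGame d d₁ d₂) (π : SamplingPartition t₀ T N) (x₀ : RVec d)
    (α : MixedStrategy d d₁ N G.γ₁) (β : MixedStrategy d d₂ N G.γ₂) :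
    Fin (N + 1) → Measure (Actions d₁ d₂ N) :=
  Fin.induction (motive := fun _ => Measure (Actions d₁ d₂ N)) (Measure.dirac 0)
    (fun k P => P.bind (G.stage π x₀ α β k))

/-- The law of the whole sequence of actions under the strategies `α` and `β`. -/
noncomputable def law (G : LQGame d d₁ d₂) (π : SamplingPartition t₀ T N) (x₀ : RVec d)
    (α : MixedStrategy d d₁ N G.γ₁) (β : MixedStrategy d d₂ N G.γ₂) :
    Measure (Actions d₁ d₂ N) :=
  G.lawUpTo π x₀ α β (Fin.last N)

/-- The expected cost `J(t₀, x₀, α, β)`. -/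
noncomputable def J (G : LQGame d d₁ d₂) (π : SamplingPartition t₀ T N) (x₀ : RVec d)
    (α : MixedStrategy d d₁ N G.γ₁) (β : MixedStrategy d d₂ N G.γ₂) : ℝ :=
  ∫ ω, G.cost π x₀ ω ∂(G.law π x₀ α β)

/-- The upper value `inf_α sup_β J`, in `[-∞, ∞]`. -/
noncomputable def upperValue (G : LQGame d d₁ d₂) (π : SamplingPartition t₀ T N)
    (x₀ : RVec d) : EReal :=
  ⨅ α : MixedStrategy d d₁ N G.γ₁, ⨆ β : MixedStrategy d d₂ N G.γ₂, (G.J π x₀ α β : EReal)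

/-- The lower value `sup_β inf_α J`, in `[-∞, ∞]`. -/
noncomputable def lowerValue (G : LQGame d d₁ d₂) (π : SamplingPartition t₀ T N)
    (x₀ : RVec d) : EReal :=
  ⨆ β : MixedStrategy d d₂ N G.γ₂, ⨅ α : MixedStrategy d d₁ N G.γ₁, (G.J π x₀ α β : EReal)

end LQGame

/-! The proof is dynamic programming. If `f` is the payoff from the next sampling instant on, stage
`k` is a one-shot zero-sum game with payoff running cost plus `f` of the next state. Its parameter
is the current state `x`, and each player chooses a law of second moment at most `γ² ‖x‖²`. Three
facts make the backward recursion work.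

The one-shot game has a value in mixed strategies. The moment bound gives no uniform integrability
for payoffs of quadratic growth, so the payoff need not be weakly continuous in the laws. Instead,
the payoff is replaced, up to a small multiple of `(1 + ‖u‖²)(1 + ‖v‖²)`, by one that depends on `u`
through `h (u, 0)` and finitely many cells (`exists_quantization`). That game is an affine pairing
of bounded convex sets in finite dimension, so Sion's theorem applies; letting the error vanish
gives `exists_mixed_value`.

The value function stays in a fixed class, and near-optimal play can be chosen measurably
(`QuadLip.exists_stage_value`). Substituting `u = ‖x‖ u'`, `v = ‖x‖ v'` removes the state from the
constraints, and increments bounded by `L ‖x - x'‖ (‖x‖ + ‖x'‖)` survive uniformly in the laws. A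
near-optimal law at a point of a dense sequence thus serves nearby states after rescaling, and
countably many choices suffice.

Finally, the expected cost is conditioned stage by stage (`integral_costTo_succ`). Kernels optimal
up to `ε / N` at every state lose at most `ε / N` per stage against any opponent, so each player
secures the initial value function at `x₀` up to `ε`. -/

set_option linter.unusedSectionVars false

/-! ### Laws with bounded second moment -/

section MomentBall

/-- The probability measures with second moment at most `c`. -/
def momentBall (X : Type*) [NormedAddCommGroup X] [MeasurableSpace X] (c : ℝ) :
    Set (Measure X) :=
  {μ | IsProbabilityMeasure μ ∧ ∫⁻ x, ‖x‖ₑ ^ 2 ∂μ ≤ ENNReal.ofReal c}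

variable {X Y : Type*} [NormedAddCommGroup X] [MeasurableSpace X] [BorelSpace X]
  [SecondCountableTopology X]
  [NormedAddCommGroup Y] [MeasurableSpace Y] [BorelSpace Y] [SecondCountableTopology Y]

theorem enorm_sq_eq_ofReal (x : X) : ‖x‖ₑ ^ 2 = ENNReal.ofReal (‖x‖ ^ 2) := by
  rw [← ofReal_norm, ENNReal.ofReal_pow (norm_nonneg _)]

theorem momentBall_mono {c c' : ℝ} (h : c ≤ c') : momentBall X c ⊆ momentBall X c' :=
  fun _ hμ => ⟨hμ.1, hμ.2.trans (ENNReal.ofReal_le_ofReal h)⟩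

theorem dirac_zero_mem_momentBall (c : ℝ) : Measure.dirac (0 : X) ∈ momentBall X c :=
  ⟨inferInstance, by rw [lintegral_dirac' _ (by fun_prop)]; simp⟩

theorem integrable_sq_norm_of_mem_momentBall {c : ℝ} {μ : Measure X} (hμ : μ ∈ momentBall X c) :
    Integrable (fun x => ‖x‖ ^ 2) μ := by
  refine ⟨by fun_prop, ?_⟩
  rw [hasFiniteIntegral_iff_ofReal (Filter.Eventually.of_forall fun x => by positivity)]
  simp_rw [← enorm_sq_eq_ofReal]
  exact hμ.2.trans_lt ENNReal.ofReal_lt_top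

theorem integral_sq_norm_le_of_mem_momentBall {c : ℝ} (hc : 0 ≤ c) {μ : Measure X}
    (hμ : μ ∈ momentBall X c) : ∫ x, ‖x‖ ^ 2 ∂μ ≤ c := by
  rw [integral_eq_lintegral_of_nonneg_ae (Filter.Eventually.of_forall fun x => by positivity)
    (by fun_prop)]
  simp_rw [← enorm_sq_eq_ofReal]
  exact ENNReal.toReal_le_of_le_ofReal hc hμ.2

theorem integrable_one_add_sq_norm {c : ℝ} {μ : Measure X} (hμ : μ ∈ momentBall X c) :
    Integrable (fun x => 1 + ‖x‖ ^ 2) μ :=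
  have := hμ.1
  (integrable_const 1).add (integrable_sq_norm_of_mem_momentBall hμ)

theorem integral_one_add_sq_norm_le {c : ℝ} (hc : 0 ≤ c) {μ : Measure X}
    (hμ : μ ∈ momentBall X c) : ∫ x, (1 + ‖x‖ ^ 2) ∂μ ≤ 1 + c := by
  have := hμ.1
  rw [integral_add (integrable_const 1) (integrable_sq_norm_of_mem_momentBall hμ)]
  simpa using integral_sq_norm_le_of_mem_momentBall hc hμ

theorem integrable_prod_of_growth {c₁ c₂ : ℝ} {μ : Measure X} {ν : Measure Y}
    (hμ : μ ∈ momentBall X c₁) (hν : ν ∈ momentBall Y c₂) {f : X × Y → ℝ} (hf : Measurable f)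
    {C : ℝ} (hC : ∀ u v, |f (u, v)| ≤ C * ((1 + ‖u‖ ^ 2) * (1 + ‖v‖ ^ 2))) :
    Integrable f (μ.prod ν) := by
  have := hμ.1
  have := hν.1
  exact (((integrable_one_add_sq_norm hμ).mul_prod
    (integrable_one_add_sq_norm hν)).const_mul C).mono'
    hf.aestronglyMeasurable (Filter.Eventually.of_forall fun p => hC p.1 p.2)

/-- The product weight factorizes under independent laws, so an error measured against it is uniform
over both moment balls. -/
theorem abs_integral_prod_le_of_growth {c₁ c₂ : ℝ} (hc₁ : 0 ≤ c₁) (hc₂ : 0 ≤ c₂)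
    {μ : Measure X} {ν : Measure Y}
    (hμ : μ ∈ momentBall X c₁) (hν : ν ∈ momentBall Y c₂) {f : X × Y → ℝ}
    {C : ℝ} (hC0 : 0 ≤ C) (hC : ∀ u v, |f (u, v)| ≤ C * ((1 + ‖u‖ ^ 2) * (1 + ‖v‖ ^ 2))) :
    |∫ p, f p ∂(μ.prod ν)| ≤ C * ((1 + c₁) * (1 + c₂)) := by
  have := hμ.1
  have := hν.1
  calc |∫ p, f p ∂(μ.prod ν)|
      ≤ ∫ p : X × Y, C * ((1 + ‖p.1‖ ^ 2) * (1 + ‖p.2‖ ^ 2)) ∂(μ.prod ν) :=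
        norm_integral_le_of_norm_le (f := f) (((integrable_one_add_sq_norm hμ).mul_prod
          (integrable_one_add_sq_norm hν)).const_mul C)
          (Filter.Eventually.of_forall fun p => hC p.1 p.2)
    _ = C * ((∫ u, (1 + ‖u‖ ^ 2) ∂μ) * ∫ v, (1 + ‖v‖ ^ 2) ∂ν) := by
        rw [integral_const_mul, integral_prod_mul (fun u => 1 + ‖u‖ ^ 2) (fun v => 1 + ‖v‖ ^ 2)]
    _ ≤ _ := by
        refine mul_le_mul_of_nonneg_left (mul_le_mul (integral_one_add_sq_norm_le hc₁ hμ)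
          (integral_one_add_sq_norm_le hc₂ hν) (integral_nonneg fun _ => ?_) ?_) hC0 <;> positivity

theorem mix_mem_momentBall {c : ℝ} {μ μ' : Measure X} (hμ : μ ∈ momentBall X c)
    (hμ' : μ' ∈ momentBall X c) {a b : ℝ} (ha : 0 ≤ a) (hb : 0 ≤ b) (hab : a + b = 1) :
    ENNReal.ofReal a • μ + ENNReal.ofReal b • μ' ∈ momentBall X c := by
  have := hμ.1
  have := hμ'.1
  refine ⟨⟨?_⟩, ?_⟩
  · simp [← ENNReal.ofReal_add ha hb, hab]
  · rw [lintegral_add_measure, lintegral_smul_measure, lintegral_smul_measure]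
    calc _ ≤ ENNReal.ofReal a * ENNReal.ofReal c + ENNReal.ofReal b * ENNReal.ofReal c := by
          simp only [smul_eq_mul]
          gcongr
          · exact hμ.2
          · exact hμ'.2
      _ = _ := by rw [← add_mul, ← ENNReal.ofReal_add ha hb, hab]; simp

theorem integral_mix {μ μ' : Measure X} {f : X → ℝ} (hf : Integrable f μ) (hf' : Integrable f μ')
    {a b : ℝ} (ha : 0 ≤ a) (hb : 0 ≤ b) :
    ∫ x, f x ∂(ENNReal.ofReal a • μ + ENNReal.ofReal b • μ') =
      a * ∫ x, f x ∂μ + b * ∫ x, f x ∂μ' := by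
  rw [integral_add_measure (hf.smul_measure ENNReal.ofReal_ne_top)
    (hf'.smul_measure ENNReal.ofReal_ne_top), integral_smul_measure, integral_smul_measure,
    ENNReal.toReal_ofReal ha, ENNReal.toReal_ofReal hb, smul_eq_mul, smul_eq_mul]

theorem map_smul_mem_momentBall [NormedSpace ℝ X] {c r : ℝ} {μ : Measure X}
    (hμ : μ ∈ momentBall X c) : μ.map (fun x => r • x) ∈ momentBall X (c * r ^ 2) := by
  have := hμ.1
  refine ⟨Measure.isProbabilityMeasure_map (by fun_prop), ?_⟩
  rw [lintegral_map (by fun_prop) (by fun_prop)]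
  simp_rw [enorm_smul, mul_pow]
  rw [lintegral_const_mul _ (by fun_prop), mul_comm c, ENNReal.ofReal_mul (by positivity),
    ← sq_abs r, ← Real.norm_eq_abs, ← enorm_sq_eq_ofReal]
  gcongr
  exact hμ.2

theorem exists_map_smul_eq_of_mem_momentBall [NormedSpace ℝ X] {c r : ℝ} (hc : 0 ≤ c)
    {μ : Measure X} (hμ : μ ∈ momentBall X (c * r ^ 2)) :
    ∃ μ' ∈ momentBall X c, μ'.map (fun x => r • x) = μ := by
  rcases eq_or_ne r 0 with rfl | hr
  · have h0 : ∫⁻ x, ‖x‖ₑ ^ 2 ∂μ = 0 := by simpa using hμ.2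
    -- A zero second moment concentrates `μ` at `0`, where multiplication by `0` is the identity.
    refine ⟨μ, momentBall_mono (by simpa using hc) hμ, ?_⟩
    rw [lintegral_eq_zero_iff (by fun_prop)] at h0
    conv_rhs => rw [← Measure.map_id (μ := μ)]
    refine Measure.map_congr ?_
    filter_upwards [h0] with x hx
    have : x = 0 := by simpa using hx
    simp [this]
  · refine ⟨μ.map (fun x => r⁻¹ • x), ?_, ?_⟩
    · have := map_smul_mem_momentBall (r := r⁻¹) hμ
      rwa [inv_pow, mul_assoc, mul_inv_cancel₀ (by positivity), mul_one] at this
    · rw [Measure.map_map (by fun_prop) (by fun_prop)]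
      convert Measure.map_id
      ext x
      simp [smul_smul, hr]

end MomentBall

/-! ### Discretizing one player's action -/

section Quantize

variable {X Y : Type*} [NormedAddCommGroup X] [MeasurableSpace X] [BorelSpace X]
  [SecondCountableTopology X] [ProperSpace X] [NormedAddCommGroup Y]

theorem exists_simpleFunc_dist_lt (R : ℝ) {δ : ℝ} (hδ : 0 < δ) :
    ∃ q : SimpleFunc X X, (∀ u, ‖u‖ ≤ R → ‖u - q u‖ < δ) ∧ ∀ u, R < ‖u‖ → q u = 0 := by
  classical
  have : Nonempty X := ⟨0⟩
  let e := TopologicalSpace.denseSeq X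
  have hcov : Metric.closedBall (0 : X) R ⊆ ⋃ n, Metric.ball (e n) δ := fun x _ => by
    obtain ⟨n, hn⟩ := (TopologicalSpace.denseRange_denseSeq X).exists_dist_lt x hδ
    exact Set.mem_iUnion.2 ⟨n, hn⟩
  obtain ⟨t, ht⟩ := (isCompact_closedBall (0 : X) R).elim_finite_subcover _
    (fun _ => Metric.isOpen_ball) hcov
  obtain ⟨M, hM⟩ := t.bddAbove
  refine ⟨SimpleFunc.piecewise (Metric.closedBall 0 R) Metric.isClosed_closedBall.measurableSet
    (SimpleFunc.nearestPt e M) (SimpleFunc.const X 0), fun u hu => ?_, fun u hu => ?_⟩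
  · have hu' : u ∈ Metric.closedBall (0 : X) R := by simpa using hu
    obtain ⟨n, hn, hun⟩ := Set.mem_iUnion₂.1 (ht hu')
    rw [SimpleFunc.coe_piecewise, Set.piecewise_eq_of_mem _ _ _ hu', ← dist_eq_norm, dist_comm]
    have h1 := SimpleFunc.edist_nearestPt_le e u (hM hn)
    rw [edist_dist, edist_dist, ENNReal.ofReal_le_ofReal_iff dist_nonneg, dist_comm (e n)] at h1
    exact h1.trans_lt hun
  · rw [SimpleFunc.coe_piecewise, Set.piecewise_eq_of_notMem _ _ _ (by simpa using hu)]
    simp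

/-- Subtracting `h (u, 0)` removes the quadratic growth in `u`: the difference is at most `L ‖v‖ (1
+ 2‖u‖ + ‖v‖)`, linear in `u`, hence negligible against the weight for large `‖u‖`. There `q` may
collapse everything to `0`; on the remaining ball a fine finite net suffices. -/
theorem exists_quantization {h : X × Y → ℝ} {L : ℝ} (hL : 0 ≤ L)
    (hh : ∀ w w', |h w - h w'| ≤ L * ‖w - w'‖ * (1 + ‖w‖ + ‖w'‖)) {η : ℝ} (hη : 0 < η) :
    ∃ q : SimpleFunc X X, ∀ u v,
      |h (u, v) - h (u, 0) - (h (q u, v) - h (q u, 0))| ≤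
        η * ((1 + ‖u‖ ^ 2) * (1 + ‖v‖ ^ 2)) := by
  have hn : ∀ (u : X) (v : Y), ‖(u, v)‖ ≤ ‖u‖ + ‖v‖ := fun u v =>
    max_le (by simp) (by simp)
  have hh1 : ∀ u u' v, |h (u, v) - h (u', v)| ≤
      L * ‖u - u'‖ * (1 + ‖u‖ + ‖u'‖ + 2 * ‖v‖) := fun u u' v => by
    refine (hh _ _).trans ?_
    have h0 : ‖((u, v) : X × Y) - (u', v)‖ = ‖u - u'‖ := by simp
    rw [h0]
    gcongr L * ‖u - u'‖ * ?_
    linarith [hn u v, hn u' v]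
  have hh2 : ∀ u v, |h (u, v) - h (u, 0)| ≤ L * ‖v‖ * (1 + 2 * ‖u‖ + ‖v‖) := fun u v => by
    refine (hh _ _).trans ?_
    have h0 : ‖((u, v) : X × Y) - (u, 0)‖ = ‖v‖ := by simp
    rw [h0]
    gcongr L * ‖v‖ * ?_
    have := hn u 0
    rw [norm_zero] at this
    linarith [hn u v]
  -- Outside radius `R` the error is at most `6 L / R` times the weight; the `+ 1` keeps `R`
  -- positive when `L = 0`.
  set R : ℝ := 6 * L / η + 1
  have hR : 0 < R := by positivity
  have hLR : 6 * L ≤ η * R := by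
    have : η * R = 6 * L + η := by simp only [R]; field_simp
    linarith
  -- Inside the ball, mesh `δ ≤ 1` costs at most `8 L δ (1 + R) (1 + ‖v‖²)`.
  set δ : ℝ := min 1 (η / (8 * (L + 1) * (1 + R)))
  have hδ : 0 < δ := by positivity
  have hδ1 : δ ≤ 1 := min_le_left _ _
  have hδ2 : 8 * L * δ * (1 + R) ≤ η := by
    have h1 : δ * (8 * (L + 1) * (1 + R)) ≤ η := by
      rw [← le_div_iff₀ (by positivity)]
      exact min_le_right _ _
    have h2 : 0 ≤ δ * (1 + R) := by positivity
    linarith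
  obtain ⟨q, hq1, hq2⟩ := exists_simpleFunc_dist_lt (X := X) R hδ
  refine ⟨q, fun u v => ?_⟩
  have hu := norm_nonneg u
  have hv := norm_nonneg v
  rcases le_or_gt ‖u‖ R with huR | huR
  · have h1 := hh1 u (q u) v
    have h2 := hh1 u (q u) 0
    have hqu : ‖q u‖ ≤ R + 1 := by
      have := norm_sub_norm_le (q u) u
      rw [norm_sub_rev] at this
      linarith [hq1 u huR]
    have hb : L * ‖u - q u‖ * (1 + ‖u‖ + ‖q u‖ + 2 * ‖v‖) ≤ L * δ * (2 + 2 * R + 2 * ‖v‖) := by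
      gcongr L * ?_ * ?_
      · exact (hq1 u huR).le
      · linarith
    have hb' : L * ‖u - q u‖ * (1 + ‖u‖ + ‖q u‖ + 2 * ‖(0 : Y)‖) ≤
        L * ‖u - q u‖ * (1 + ‖u‖ + ‖q u‖ + 2 * ‖v‖) := by
      gcongr
      simp
    have hle : |h (u, v) - h (u, 0) - (h (q u, v) - h (q u, 0))| ≤
        |h (u, v) - h (q u, v)| + |h (u, 0) - h (q u, 0)| := by
      refine le_trans (le_of_eq ?_) (abs_sub _ _)
      congr 1
      ring
    have hc : 2 + 2 * R + 2 * ‖v‖ ≤ (1 + R) * (2 * (1 + ‖v‖)) := by nlinarith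
    have hd : 2 * (1 + ‖v‖) ≤ 4 * (1 + ‖v‖ ^ 2) := by nlinarith [sq_nonneg (‖v‖ - 1)]
    calc _ ≤ 2 * (L * δ * (2 + 2 * R + 2 * ‖v‖)) := by linarith
      _ ≤ 2 * (L * δ * ((1 + R) * (4 * (1 + ‖v‖ ^ 2)))) := by
        gcongr 2 * (L * δ * ?_)
        exact hc.trans (by gcongr)
      _ = (8 * L * δ * (1 + R)) * (1 * (1 + ‖v‖ ^ 2)) := by ring
      _ ≤ _ := by
        gcongr
        linarith [sq_nonneg ‖u‖]
  · rw [hq2 u huR]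
    have h1 := hh2 u v
    have h2 := hh2 0 v
    rw [norm_zero] at h2
    have hle := abs_sub (h (u, v) - h (u, 0)) (h (0, v) - h (0, 0))
    have hs : ‖v‖ * (1 + ‖u‖ + ‖v‖) * ‖u‖ ≤ 3 * ((1 + ‖u‖ ^ 2) * (1 + ‖v‖ ^ 2)) := by
      nlinarith [sq_nonneg (‖u‖ * ‖v‖ - ‖u‖), sq_nonneg (‖u‖ * ‖v‖ - ‖v‖), sq_nonneg (‖u‖ - ‖v‖),
        sq_nonneg (‖u‖ - 1), sq_nonneg (‖v‖ - 1), sq_nonneg (‖u‖ * ‖v‖ - 1), sq_nonneg (‖u‖ * ‖v‖)]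
    refine le_of_mul_le_mul_right ?_ hR
    calc _ ≤ (2 * L * (‖v‖ * (1 + ‖u‖ + ‖v‖))) * R := by
          gcongr
          nlinarith [mul_nonneg hL hv]
      _ ≤ (2 * L * (‖v‖ * (1 + ‖u‖ + ‖v‖))) * ‖u‖ := by gcongr
      _ = 2 * L * (‖v‖ * (1 + ‖u‖ + ‖v‖) * ‖u‖) := by ring
      _ ≤ 2 * L * (3 * ((1 + ‖u‖ ^ 2) * (1 + ‖v‖ ^ 2))) := by gcongr
      _ = 6 * L * ((1 + ‖u‖ ^ 2) * (1 + ‖v‖ ^ 2)) := by ring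
      _ ≤ (η * R) * ((1 + ‖u‖ ^ 2) * (1 + ‖v‖ ^ 2)) := by gcongr
      _ = _ := by ring

end Quantize

/-! ### Approximate saddle points in finite dimension -/

section FiniteDimensional

variable {ι : Type*} [Fintype ι]

/-- The pairing `a₀ + ∑ aᵢ bᵢ`. -/
def affinePairing (a : ℝ × (ι → ℝ)) (b : ι → ℝ) : ℝ := a.1 + ∑ i, a.2 i * b i

theorem continuous_affinePairing_left (b : ι → ℝ) : Continuous fun a => affinePairing a b := by
  unfold affinePairing
  fun_prop

theorem continuous_affinePairing_right (a : ℝ × (ι → ℝ)) : Continuous (affinePairing a) := by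
  unfold affinePairing
  fun_prop

theorem abs_affinePairing_sub_left_le (a a' : ℝ × (ι → ℝ)) (b : ι → ℝ) :
    |affinePairing a b - affinePairing a' b| ≤ ‖a - a'‖ * (1 + Fintype.card ι * ‖b‖) := by
  have h : affinePairing a b - affinePairing a' b =
      (a - a').1 + ∑ i, (a - a').2 i * b i := by
    simp only [affinePairing, Prod.fst_sub, Prod.snd_sub, Pi.sub_apply, sub_mul,
      Finset.sum_sub_distrib]
    ring
  rw [h, mul_add, mul_one]
  refine (abs_add_le _ _).trans (add_le_add (norm_fst_le (a - a')) ?_)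
  refine (Finset.abs_sum_le_sum_abs _ _).trans ?_
  calc _ ≤ ∑ _i : ι, ‖a - a'‖ * ‖b‖ := by
        refine Finset.sum_le_sum fun i _ => ?_
        rw [abs_mul]
        gcongr
        · exact (norm_le_pi_norm (a - a').2 i).trans (norm_snd_le _)
        · exact norm_le_pi_norm b i
    _ = _ := by simp; ring

theorem abs_affinePairing_sub_right_le (a : ℝ × (ι → ℝ)) (b b' : ι → ℝ) :
    |affinePairing a b - affinePairing a b'| ≤ ‖b - b'‖ * (Fintype.card ι * ‖a‖) := by
  have h : affinePairing a b - affinePairing a b' = ∑ i, a.2 i * (b - b') i := by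
    simp only [affinePairing, Pi.sub_apply, mul_sub, Finset.sum_sub_distrib]
    ring
  rw [h]
  refine (Finset.abs_sum_le_sum_abs _ _).trans ?_
  calc _ ≤ ∑ _i : ι, ‖a‖ * ‖b - b'‖ := by
        refine Finset.sum_le_sum fun i _ => ?_
        rw [abs_mul]
        gcongr
        · exact (norm_le_pi_norm a.2 i).trans (norm_snd_le _)
        · exact norm_le_pi_norm (b - b') i
    _ = _ := by simp; ring

theorem exists_mem_norm_sub_mul_le {E : Type*} [NormedAddCommGroup E] {A : Set E} {x : E}
    (hx : x ∈ closure A) {C ε : ℝ} (hC : 0 ≤ C) (hε : 0 < ε) : ∃ a ∈ A, ‖a - x‖ * C ≤ ε := by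
  obtain ⟨a, ha, h⟩ := Metric.mem_closure_iff.1 hx (ε / (C + 1)) (by positivity)
  refine ⟨a, ha, ?_⟩
  rw [dist_comm, dist_eq_norm, lt_div_iff₀ (by positivity)] at h
  nlinarith [norm_nonneg (a - x)]

/-- The closures of `A` and `B` are compact and convex, and the pairing is affine in each variable,
so Sion gives a saddle point there. The pairing is Lipschitz in each variable, uniformly over the
other bounded set, so each component moves back into its set at cost `ε`. -/
theorem exists_approx_saddle {A : Set (ℝ × (ι → ℝ))} {B : Set (ι → ℝ)}
    (hA : Convex ℝ A) (hB : Convex ℝ B) (hA' : Bornology.IsBounded A)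
    (hB' : Bornology.IsBounded B) (hAn : A.Nonempty) (hBn : B.Nonempty) {ε : ℝ} (hε : 0 < ε) :
    ∃ V : ℝ, (∃ a ∈ A, ∀ b ∈ B, affinePairing a b ≤ V + ε) ∧
      ∃ b ∈ B, ∀ a ∈ A, V - ε ≤ affinePairing a b := by
  obtain ⟨a, ha, b, hb, hab⟩ := Sion.exists_isSaddlePointOn (f := affinePairing)
    (X := closure A) (Y := closure B)
    hAn.closure hA.closure (hA'.isCompact_closure)
    (fun b _ => (continuous_affinePairing_left b).lowerSemicontinuous.lowerSemicontinuousOn _)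
    (fun b _ => by
      refine ConvexOn.quasiconvexOn ⟨hA.closure, fun x _ y _ s t _ _ hst => le_of_eq ?_⟩
      simp only [affinePairing, Prod.fst_add, Prod.snd_add, Prod.smul_fst, Prod.smul_snd,
        Pi.add_apply, Pi.smul_apply, smul_eq_mul, mul_add, add_mul, Finset.mul_sum,
        Finset.sum_add_distrib, mul_assoc]
      ring)
    hB.closure hBn.closure (hB'.isCompact_closure)
    (fun a _ => (continuous_affinePairing_right a).upperSemicontinuous.upperSemicontinuousOn _)
    (fun a _ => by
      refine ConcaveOn.quasiconcaveOn ⟨hB.closure, fun x _ y _ s t _ _ hst => le_of_eq ?_⟩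
      have h1 : a.1 = s * a.1 + t * a.1 := by rw [← add_mul, hst, one_mul]
      simp only [affinePairing, Pi.add_apply, Pi.smul_apply, smul_eq_mul, mul_add,
        Finset.mul_sum, Finset.sum_add_distrib, mul_left_comm _ s, mul_left_comm _ t]
      linarith)
  obtain ⟨CA, hCA⟩ := hA'.exists_norm_le
  obtain ⟨CB, hCB⟩ := hB'.exists_norm_le
  have hCA0 : 0 ≤ CA := (norm_nonneg _).trans (hCA _ hAn.some_mem)
  have hCB0 : 0 ≤ CB := (norm_nonneg _).trans (hCB _ hBn.some_mem)
  obtain ⟨a', ha', h1⟩ := exists_mem_norm_sub_mul_le ha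
    (C := 1 + Fintype.card ι * CB) (by positivity) hε
  obtain ⟨b', hb', h2⟩ := exists_mem_norm_sub_mul_le hb
    (C := Fintype.card ι * CA) (by positivity) hε
  refine ⟨affinePairing a b, ⟨a', ha', fun y hy => ?_⟩, b', hb', fun x hx => ?_⟩
  · have h3 := (abs_le.1 (abs_affinePairing_sub_left_le a' a y)).2
    have h4 : ‖a' - a‖ * (1 + Fintype.card ι * ‖y‖) ≤ ‖a' - a‖ * (1 + Fintype.card ι * CB) := by
      gcongr
      exact hCB y hy
    linarith [hab a ha y (subset_closure hy)]
  · have h3 := (abs_le.1 (abs_affinePairing_sub_right_le x b' b)).1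
    have h4 : ‖b' - b‖ * (Fintype.card ι * ‖x‖) ≤ ‖b' - b‖ * (Fintype.card ι * CA) := by
      gcongr
      exact hCA x hx
    linarith [hab x (subset_closure hx) b hb]

end FiniteDimensional

/-! ### The one-shot game on moment balls -/

section Minimax

variable {X Y : Type*} [NormedAddCommGroup X] [MeasurableSpace X] [BorelSpace X]
  [SecondCountableTopology X] [ProperSpace X]
  [NormedAddCommGroup Y] [MeasurableSpace Y] [BorelSpace Y] [SecondCountableTopology Y]

theorem continuous_of_abs_sub_le {E : Type*} [NormedAddCommGroup E] {h : E → ℝ} {L : ℝ}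
    (hh : ∀ w w', |h w - h w'| ≤ L * ‖w - w'‖ * (1 + ‖w‖ + ‖w'‖)) : Continuous h := by
  rw [continuous_iff_continuousAt]
  intro w
  rw [ContinuousAt, tendsto_iff_norm_sub_tendsto_zero]
  have h0 : Filter.Tendsto (fun w' => L * ‖w' - w‖ * (1 + ‖w'‖ + ‖w‖)) (nhds w) (nhds 0) := by
    have : Continuous fun w' => L * ‖w' - w‖ * (1 + ‖w'‖ + ‖w‖) := by fun_prop
    simpa using this.tendsto w
  exact squeeze_zero (fun _ => norm_nonneg _) (fun w' => hh w' w) h0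

theorem exists_abs_le_of_abs_sub_le {h : X × Y → ℝ} {L : ℝ} (hL : 0 ≤ L)
    (hh : ∀ w w', |h w - h w'| ≤ L * ‖w - w'‖ * (1 + ‖w‖ + ‖w'‖)) :
    ∃ C, 0 ≤ C ∧ ∀ u v, |h (u, v)| ≤ C * ((1 + ‖u‖ ^ 2) * (1 + ‖v‖ ^ 2)) := by
  refine ⟨|h 0| + 4 * L, by positivity, fun u v => ?_⟩
  have h1 := hh (u, v) 0
  have h2 := abs_sub_abs_le_abs_sub (h (u, v)) (h 0)
  have hn : ‖(u, v)‖ ≤ ‖u‖ + ‖v‖ := max_le (by simp) (by simp)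
  rw [sub_zero, norm_zero, add_zero] at h1
  have h3 : L * ‖(u, v)‖ * (1 + ‖(u, v)‖) ≤ L * ((‖u‖ + ‖v‖) * (1 + (‖u‖ + ‖v‖))) := by
    rw [mul_assoc]
    gcongr
  have h4 : (‖u‖ + ‖v‖) * (1 + (‖u‖ + ‖v‖)) ≤ 4 * ((1 + ‖u‖ ^ 2) * (1 + ‖v‖ ^ 2)) := by
    nlinarith [sq_nonneg (‖u‖ - 1), sq_nonneg (‖v‖ - 1), sq_nonneg (‖u‖ - ‖v‖),
      sq_nonneg (‖u‖ * ‖v‖)]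
  have h5 : |h 0| * 1 ≤ |h 0| * ((1 + ‖u‖ ^ 2) * (1 + ‖v‖ ^ 2)) := by
    gcongr
    nlinarith [sq_nonneg ‖u‖, sq_nonneg ‖v‖, sq_nonneg (‖u‖ * ‖v‖)]
  have h6 := mul_le_mul_of_nonneg_left h4 hL
  linarith

/-- After quantization a law `μ` matters only through its mean of `h (·, 0)` and its cell masses,
and `ν` only through its mean gains at the cell representatives. These statistics form bounded
convex sets paired affinely. -/
theorem exists_approx_value {h : X × Y → ℝ} {L : ℝ} (hL : 0 ≤ L)
    (hh : ∀ w w', |h w - h w'| ≤ L * ‖w - w'‖ * (1 + ‖w‖ + ‖w'‖)) {c₁ c₂ : ℝ} (hc₁ : 0 ≤ c₁)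
    (hc₂ : 0 ≤ c₂) {ε : ℝ} (hε : 0 < ε) :
    ∃ V : ℝ, (∃ μ ∈ momentBall X c₁, ∀ ν ∈ momentBall Y c₂, ∫ p, h p ∂(μ.prod ν) ≤ V + ε) ∧
      ∃ ν ∈ momentBall Y c₂, ∀ μ ∈ momentBall X c₁, V - ε ≤ ∫ p, h p ∂(μ.prod ν) := by
  classical
  obtain ⟨C, hC0, hC⟩ := exists_abs_le_of_abs_sub_le hL hh
  have hm : Measurable h := (continuous_of_abs_sub_le hh).measurable
  -- The weight integrates to at most `(1 + c₁) (1 + c₂)`, so this `η` makes the total quantization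
  -- error at most `ε / 2`; the approximate saddle spends the other half.
  obtain ⟨q, hq⟩ := exists_quantization hL hh
    (η := ε / 2 / ((1 + c₁) * (1 + c₂))) (by positivity)
  have hC1 : ∀ u, |h (u, 0)| ≤ C * (1 + ‖u‖ ^ 2) := fun u => by simpa using hC u 0
  have hi1 : ∀ μ ∈ momentBall X c₁, Integrable (fun u => h (u, 0)) μ := fun μ hμ =>
    ((integrable_one_add_sq_norm hμ).const_mul C).mono'
      (hm.comp (by fun_prop)).aestronglyMeasurable
      (Filter.Eventually.of_forall hC1)
  have hi2 : ∀ ν ∈ momentBall Y c₂, ∀ s, Integrable (fun v => h (s, v)) ν := fun ν hν s =>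
    ((integrable_one_add_sq_norm hν).const_mul (C * (1 + ‖s‖ ^ 2))).mono'
      (hm.comp (by fun_prop)).aestronglyMeasurable
      (Filter.Eventually.of_forall fun v => by rw [mul_assoc]; exact hC s v)
  let ind : q.range → X → ℝ := fun i u => if q u = i then 1 else 0
  have hindm : ∀ i, Measurable (ind i) := fun i =>
    Measurable.ite (q.measurableSet_fiber i) measurable_const measurable_const
  have hind1 : ∀ i u, ‖ind i u‖ ≤ 1 := fun i u => by
    simp only [ind]
    split_ifs <;> simp
  have hi3 : ∀ μ ∈ momentBall X c₁, ∀ i, Integrable (ind i) μ := fun μ hμ i => by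
    have := hμ.1
    exact (integrable_const (1 : ℝ)).mono' (hindm i).aestronglyMeasurable
      (Filter.Eventually.of_forall (hind1 i))
  let a : Measure X → ℝ × (q.range → ℝ) := fun μ => (∫ u, h (u, 0) ∂μ, fun i => ∫ u, ind i u ∂μ)
  let b : Measure Y → q.range → ℝ := fun ν i => ∫ v, (h (i, v) - h (i, 0)) ∂ν
  have hi4 : ∀ ν ∈ momentBall Y c₂, ∀ s, Integrable (fun v => h (s, v) - h (s, 0)) ν :=
    fun ν hν s => by
      have := hν.1
      exact (hi2 ν hν s).sub (integrable_const _)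
  have key : ∀ μ ∈ momentBall X c₁, ∀ ν ∈ momentBall Y c₂,
      |∫ p, h p ∂(μ.prod ν) - affinePairing (a μ) (b ν)| ≤ ε / 2 := fun μ hμ ν hν => by
    have := hμ.1
    have := hν.1
    have hsum : ∀ i, Integrable
        (fun p : X × Y => ind i p.1 * (h (i, p.2) - h (i, 0))) (μ.prod ν) :=
      fun i => (hi3 μ hμ i).mul_prod (hi4 ν hν i)
    have hfst : Integrable (fun p : X × Y => h (p.1, 0)) (μ.prod ν) := (hi1 μ hμ).comp_fst ν
    have hpair : affinePairing (a μ) (b ν) =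
        ∫ p, (h (p.1, 0) + ∑ i, ind i p.1 * (h (i, p.2) - h (i, 0))) ∂(μ.prod ν) := by
      rw [integral_add hfst (integrable_finsetSum _ fun i _ => hsum i),
        integral_finsetSum _ fun i _ => hsum i, integral_fun_fst (fun u => h (u, 0))]
      simp only [affinePairing, a, b, probReal_univ, one_smul]
      congr 1
      refine Finset.sum_congr rfl fun i _ => ?_
      exact (integral_prod_mul (ind i) fun v => h (i, v) - h (i, 0)).symm
    have hall : Integrable (fun p : X × Y =>
        h (p.1, 0) + ∑ i, ind i p.1 * (h (i, p.2) - h (i, 0))) (μ.prod ν) :=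
      hfst.add (integrable_finsetSum _ fun i _ => hsum i)
    rw [hpair, ← integral_sub (integrable_prod_of_growth hμ hν hm hC) hall]
    refine (abs_integral_prod_le_of_growth hc₁ hc₂ hμ hν (by positivity) fun u v => ?_).trans
      (le_of_eq (div_mul_cancel₀ _ (by positivity)))
    have hs : ∑ i, ind i u * (h (i, v) - h (i, 0)) = h (q u, v) - h (q u, 0) := by
      rw [Finset.sum_eq_single (⟨q u, q.mem_range_self u⟩ : q.range)]
      · simp [ind]
      · intro i _ hi
        have : q u ≠ i := fun h' => hi (Subtype.ext h'.symm)
        simp [ind, this]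
      · simp
    simp only [hs]
    rw [← sub_sub]
    exact hq u v
  have hA : Convex ℝ (a '' momentBall X c₁) := by
    rintro _ ⟨μ, hμ, rfl⟩ _ ⟨μ', hμ', rfl⟩ s t hs ht hst
    refine ⟨_, mix_mem_momentBall hμ hμ' hs ht hst, ?_⟩
    ext i
    · exact integral_mix (hi1 μ hμ) (hi1 μ' hμ') hs ht
    · exact integral_mix (hi3 μ hμ i) (hi3 μ' hμ' i) hs ht
  have hB : Convex ℝ (b '' momentBall Y c₂) := by
    rintro _ ⟨ν, hν, rfl⟩ _ ⟨ν', hν', rfl⟩ s t hs ht hst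
    refine ⟨_, mix_mem_momentBall hν hν' hs ht hst, ?_⟩
    ext i
    exact integral_mix (hi4 ν hν i) (hi4 ν' hν' i) hs ht
  have hA' : Bornology.IsBounded (a '' momentBall X c₁) := by
    refine isBounded_iff_forall_norm_le.2 ⟨max (C * (1 + c₁)) 1, ?_⟩
    rintro _ ⟨μ, hμ, rfl⟩
    have := hμ.1
    refine max_le_max ?_ ((pi_norm_le_iff_of_nonneg zero_le_one).2 fun i => ?_)
    · refine (norm_integral_le_of_norm_le ((integrable_one_add_sq_norm hμ).const_mul C)
        (Filter.Eventually.of_forall hC1)).trans ?_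
      rw [integral_const_mul]
      gcongr
      exact integral_one_add_sq_norm_le hc₁ hμ
    · exact (norm_integral_le_of_norm_le (integrable_const (1 : ℝ))
        (Filter.Eventually.of_forall (hind1 i))).trans (by simp)
  have hB' : Bornology.IsBounded (b '' momentBall Y c₂) := by
    refine isBounded_iff_forall_norm_le.2
      ⟨∑ i : q.range, 2 * (C * (1 + ‖(i : X)‖ ^ 2)) * (1 + c₂), ?_⟩
    rintro _ ⟨ν, hν, rfl⟩
    have := hν.1
    refine (pi_norm_le_iff_of_nonneg (Finset.sum_nonneg fun i _ => by positivity)).2 fun i => ?_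
    refine le_trans ?_ (Finset.single_le_sum (fun i _ => by positivity) (Finset.mem_univ i))
    refine (norm_integral_le_of_norm_le ((integrable_one_add_sq_norm hν).const_mul
        (2 * (C * (1 + ‖(i : X)‖ ^ 2))))
        (Filter.Eventually.of_forall fun v => ?_)).trans ?_
    · have h1 := hC i v
      have h2 := hC1 i
      have h3 : C * (1 + ‖(i : X)‖ ^ 2) * 1 ≤ C * (1 + ‖(i : X)‖ ^ 2) * (1 + ‖v‖ ^ 2) := by
        gcongr
        linarith [sq_nonneg ‖v‖]
      refine (abs_sub _ _).trans ?_
      linarith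
    · rw [integral_const_mul]
      gcongr
      exact integral_one_add_sq_norm_le hc₂ hν
  obtain ⟨V, ⟨_, ⟨μ, hμ, rfl⟩, h1⟩, _, ⟨ν, hν, rfl⟩, h2⟩ := exists_approx_saddle hA hB hA' hB'
    ⟨_, _, dirac_zero_mem_momentBall c₁, rfl⟩ ⟨_, _, dirac_zero_mem_momentBall c₂, rfl⟩
    (half_pos hε)
  refine ⟨V, ⟨μ, hμ, fun ν' hν' => ?_⟩, ν, hν, fun μ' hμ' => ?_⟩
  · linarith [h1 _ ⟨ν', hν', rfl⟩, (abs_le.1 (key μ hμ ν' hν')).2]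
  · linarith [h2 _ ⟨μ', hμ', rfl⟩, (abs_le.1 (key μ' hμ' ν hν)).1]

/-- The approximate value depends on `ε`. The supremum of the levels that the maximizer can
guarantee does not, and within every `ε` some such level is matched by a ceiling of the minimizer.
-/
theorem exists_mixed_value {h : X × Y → ℝ} {L : ℝ} (hL : 0 ≤ L)
    (hh : ∀ w w', |h w - h w'| ≤ L * ‖w - w'‖ * (1 + ‖w‖ + ‖w'‖)) {c₁ c₂ : ℝ} (hc₁ : 0 ≤ c₁)
    (hc₂ : 0 ≤ c₂) :
    ∃ V : ℝ, ∀ ε > 0,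
      (∃ μ ∈ momentBall X c₁, ∀ ν ∈ momentBall Y c₂, ∫ p, h p ∂(μ.prod ν) ≤ V + ε) ∧
      ∃ ν ∈ momentBall Y c₂, ∀ μ ∈ momentBall X c₁, V - ε ≤ ∫ p, h p ∂(μ.prod ν) := by
  let S : Set ℝ := {c | ∃ ν ∈ momentBall Y c₂, ∀ μ ∈ momentBall X c₁, c ≤ ∫ p, h p ∂(μ.prod ν)}
  have hup : ∀ ε > 0, ∃ c ∈ S, ∃ μ ∈ momentBall X c₁, ∀ ν ∈ momentBall Y c₂,
      ∫ p, h p ∂(μ.prod ν) ≤ c + ε := fun ε hε => by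
    obtain ⟨V, ⟨μ, hμ, h1⟩, h2⟩ := exists_approx_value hL hh hc₁ hc₂ (half_pos hε)
    exact ⟨V - ε / 2, h2, μ, hμ, fun ν hν => by linarith [h1 ν hν]⟩
  have hS : BddAbove S := by
    obtain ⟨c, -, μ, hμ, h1⟩ := hup 1 one_pos
    exact ⟨c + 1, fun y ⟨ν, hν, hy⟩ => (hy μ hμ).trans (h1 ν hν)⟩
  have hSn : S.Nonempty := by
    obtain ⟨c, hc, -⟩ := hup 1 one_pos
    exact ⟨c, hc⟩
  refine ⟨sSup S, fun ε hε => ⟨?_, ?_⟩⟩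
  · obtain ⟨c, hc, μ, hμ, h1⟩ := hup ε hε
    exact ⟨μ, hμ, fun ν hν => (h1 ν hν).trans (by gcongr; exact le_csSup hS hc)⟩
  · obtain ⟨c, ⟨ν, hν, h1⟩, hc⟩ := exists_lt_of_lt_csSup hSn (sub_lt_self _ hε)
    exact ⟨ν, hν, fun μ hμ => hc.le.trans (h1 μ hμ)⟩

end Minimax

/-! ### Functions with quadratic-type increments -/

section QuadLip

variable {E F : Type*} [NormedAddCommGroup E] [NormedAddCommGroup F]

/-- Functions whose increments are controlled like those of a quadratic form. -/
def QuadLip (f : E → ℝ) : Prop :=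
  ∃ L, 0 ≤ L ∧ ∀ z z', |f z - f z'| ≤ L * ‖z - z'‖ * (‖z‖ + ‖z'‖)

theorem QuadLip.continuous {f : E → ℝ} (hf : QuadLip f) : Continuous f := by
  obtain ⟨L, hL, h⟩ := hf
  refine continuous_of_abs_sub_le (L := L) fun z z' => (h z z').trans ?_
  gcongr
  linarith

theorem QuadLip.add {f g : E → ℝ} (hf : QuadLip f) (hg : QuadLip g) :
    QuadLip fun z => f z + g z := by
  obtain ⟨L, hL, h⟩ := hf
  obtain ⟨L', hL', h'⟩ := hg
  refine ⟨L + L', by positivity, fun z z' => ?_⟩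
  have := abs_add_le (f z - f z') (g z - g z')
  have h1 := h z z'
  have h2 := h' z z'
  calc _ = |f z - f z' + (g z - g z')| := by congr 1; ring
    _ ≤ _ := by linarith

theorem QuadLip.comp [NormedSpace ℝ E] [NormedSpace ℝ F] {f : F → ℝ} (hf : QuadLip f)
    (A : E →L[ℝ] F) : QuadLip fun z => f (A z) := by
  obtain ⟨L, hL, h⟩ := hf
  refine ⟨L * ‖A‖ * ‖A‖, by positivity, fun z z' => (h _ _).trans ?_⟩
  rw [← map_sub]
  calc _ ≤ L * (‖A‖ * ‖z - z'‖) * (‖A‖ * ‖z‖ + ‖A‖ * ‖z'‖) := by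
        gcongr <;> exact A.le_opNorm _
    _ = _ := by ring

theorem QuadLip.exists_abs_le {f : E → ℝ} (hf : QuadLip f) :
    ∃ C, 0 ≤ C ∧ ∀ z, |f z| ≤ C * (1 + ‖z‖ ^ 2) := by
  obtain ⟨L, hL, h⟩ := hf
  refine ⟨|f 0| + L, by positivity, fun z => ?_⟩
  have h1 := h z 0
  have h2 := abs_sub_abs_le_abs_sub (f z) (f 0)
  rw [sub_zero, norm_zero, add_zero] at h1
  nlinarith [mul_nonneg (abs_nonneg (f 0)) (sq_nonneg ‖z‖)]

end QuadLip

/-! ### State-dependent stage games and measurable near-optimal play -/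

section StageValue

variable {E X Y : Type*}
  [NormedAddCommGroup E] [MeasurableSpace E] [BorelSpace E] [SecondCountableTopology E]
  [NormedAddCommGroup X] [NormedSpace ℝ X] [MeasurableSpace X] [BorelSpace X]
  [SecondCountableTopology X] [ProperSpace X]
  [NormedAddCommGroup Y] [NormedSpace ℝ Y] [MeasurableSpace Y] [BorelSpace Y]
  [SecondCountableTopology Y] [ProperSpace Y]

/-- The base law takes countably many values, so measurability reduces to that of the index; the
scale `‖x‖` is applied afterwards by a jointly measurable map. -/
theorem exists_kernel_smul {ix : E → ℕ} (hix : Measurable ix) {m : ℕ → Measure X}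
    (hm : ∀ n, IsProbabilityMeasure (m n)) :
    ∃ κ : Kernel E X, ∀ x, κ x = (m (ix x)).map fun u => ‖x‖ • u := by
  have : IsMarkovKernel (Kernel.ofFunOfCountable m) := ⟨hm⟩
  refine ⟨(Kernel.id ×ₖ (Kernel.ofFunOfCountable m).comap ix hix).map
    (fun p : E × X => ‖p.1‖ • p.2), fun x => ?_⟩
  rw [Kernel.map_apply _ (by fun_prop), Kernel.prod_apply, Kernel.id_apply, Kernel.comap_apply,
    Measure.dirac_prod, Measure.map_map (by fun_prop) (by fun_prop)]
  rfl

theorem exists_measurable_index {L ε : ℝ} (hε : 0 < ε) :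
    ∃ ix : E → ℕ, Measurable ix ∧ ∀ x,
      L * ‖x - TopologicalSpace.denseSeq E (ix x)‖ *
        (‖x‖ + ‖TopologicalSpace.denseSeq E (ix x)‖) < ε := by
  classical
  have : Nonempty E := ⟨0⟩
  have hex : ∀ x : E, ∃ n, L * ‖x - TopologicalSpace.denseSeq E n‖ *
      (‖x‖ + ‖TopologicalSpace.denseSeq E n‖) < ε := fun x => by
    have ho : IsOpen {y : E | L * ‖x - y‖ * (‖x‖ + ‖y‖) < ε} :=
      isOpen_lt (by fun_prop) continuous_const
    exact (TopologicalSpace.denseRange_denseSeq E).exists_mem_open ho ⟨x, by simpa using hε⟩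
  -- The least admissible index is measurable because each admissibility condition is an open one;
  -- density applies since the bound vanishes at `y = x`.
  exact ⟨fun x => Nat.find (hex x), measurable_find hex fun n =>
    measurableSet_lt (by fun_prop) measurable_const, fun x => Nat.find_spec (hex x)⟩

theorem integral_prod_map_smul {f : X × Y → ℝ} (hf : Continuous f) (r : ℝ) (μ : Measure X)
    (ν : Measure Y) [IsProbabilityMeasure μ] [IsProbabilityMeasure ν] :
    ∫ p, f p ∂((μ.map fun u => r • u).prod (ν.map fun v => r • v)) =
      ∫ p, f (r • p) ∂(μ.prod ν) := by
  rw [Measure.map_prod_map _ _ (by fun_prop) (by fun_prop),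
    integral_map (by fun_prop) hf.aestronglyMeasurable]
  rfl

/-- Since `‖·‖` is 1-Lipschitz, `x ↦ (x, ‖x‖ • p)` has both its norm and its increments enlarged by
at most `1 + ‖p‖`. The resulting factor `(1 + ‖p‖)²` is at most twice the product weight, which
integrates uniformly. -/
theorem QuadLip.exists_scaled_sub_le {f : E × (X × Y) → ℝ} (hf : QuadLip f) {c₁ c₂ : ℝ}
    (hc₁ : 0 ≤ c₁) (hc₂ : 0 ≤ c₂) :
    ∃ L, 0 ≤ L ∧ ∀ x x', ∀ μ ∈ momentBall X c₁, ∀ ν ∈ momentBall Y c₂,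
      |∫ p, f (x, ‖x‖ • p) ∂(μ.prod ν) - ∫ p, f (x', ‖x'‖ • p) ∂(μ.prod ν)| ≤
        L * ‖x - x'‖ * (‖x‖ + ‖x'‖) := by
  have hfc := hf.continuous
  obtain ⟨C, hC0, hC⟩ := hf.exists_abs_le
  obtain ⟨L, hL, h⟩ := hf
  have hn : ∀ (u : X) (v : Y), (1 + ‖(u, v)‖) ^ 2 ≤ 2 * ((1 + ‖u‖ ^ 2) * (1 + ‖v‖ ^ 2)) :=
    fun u v => by
      have : ‖(u, v)‖ ^ 2 ≤ ‖u‖ ^ 2 + ‖v‖ ^ 2 := by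
        rw [Prod.norm_def]
        rcases max_cases ‖u‖ ‖v‖ with h | h <;> rw [h.1] <;>
          nlinarith [sq_nonneg ‖u‖, sq_nonneg ‖v‖]
      nlinarith [sq_nonneg (‖(u, v)‖ - 1), sq_nonneg (‖u‖ * ‖v‖)]
  have hint : ∀ x, ∀ μ ∈ momentBall X c₁, ∀ ν ∈ momentBall Y c₂,
      Integrable (fun p => f (x, ‖x‖ • p)) (μ.prod ν) := fun x μ hμ ν hν => by
    refine integrable_prod_of_growth hμ hν (by fun_prop) (C := C * (1 + ‖x‖ ^ 2) * 2)
      fun u v => (hC _).trans ?_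
    have h1 : ‖(x, ‖x‖ • (u, v))‖ ≤ ‖x‖ * (1 + ‖(u, v)‖) := by
      rw [Prod.norm_def]
      refine max_le ?_ ?_
      · nlinarith [norm_nonneg x, norm_nonneg (u, v)]
      · simp only [norm_smul, norm_norm]
        nlinarith [norm_nonneg x, norm_nonneg (u, v)]
    have h2 : 1 + ‖(x, ‖x‖ • (u, v))‖ ^ 2 ≤ (1 + ‖x‖ ^ 2) * (1 + ‖(u, v)‖) ^ 2 := by
      have h3 : ‖(x, ‖x‖ • (u, v))‖ ^ 2 ≤ (‖x‖ * (1 + ‖(u, v)‖)) ^ 2 := by gcongr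
      nlinarith [norm_nonneg (u, v)]
    rw [mul_assoc, mul_assoc]
    gcongr C * ?_
    exact h2.trans (by gcongr; exact hn u v)
  refine ⟨L * 2 * ((1 + c₁) * (1 + c₂)), by positivity, fun x x' μ hμ ν hν => ?_⟩
  rw [← integral_sub (hint x μ hμ ν hν) (hint x' μ hμ ν hν)]
  have hb := abs_integral_prod_le_of_growth hc₁ hc₂ hμ hν
    (f := fun p => f (x, ‖x‖ • p) - f (x', ‖x'‖ • p))
    (C := L * 2 * ‖x - x'‖ * (‖x‖ + ‖x'‖)) (by positivity) fun u v => by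
      refine (h _ _).trans ?_
      have h1 : ∀ y : E, ‖(y, ‖y‖ • (u, v))‖ ≤ ‖y‖ * (1 + ‖(u, v)‖) := fun y => by
        rw [Prod.norm_def]
        refine max_le ?_ ?_
        · nlinarith [norm_nonneg y, norm_nonneg (u, v)]
        · simp only [norm_smul, norm_norm]
          nlinarith [norm_nonneg y, norm_nonneg (u, v)]
      have h2 : ‖(x, ‖x‖ • (u, v)) - (x', ‖x'‖ • (u, v))‖ ≤ ‖x - x'‖ * (1 + ‖(u, v)‖) := by
        rw [Prod.mk_sub_mk, ← sub_smul, Prod.norm_def]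
        refine max_le ?_ ?_
        · nlinarith [norm_nonneg (x - x'), norm_nonneg (u, v)]
        · simp only [norm_smul, Real.norm_eq_abs]
          have := abs_norm_sub_norm_le x x'
          nlinarith [norm_nonneg (x - x'), norm_nonneg (u, v)]
      calc _ ≤ L * (‖x - x'‖ * (1 + ‖(u, v)‖)) *
            (‖x‖ * (1 + ‖(u, v)‖) + ‖x'‖ * (1 + ‖(u, v)‖)) := by
            gcongr
            · exact h1 x
            · exact h1 x'
        _ = L * ‖x - x'‖ * (‖x‖ + ‖x'‖) * (1 + ‖(u, v)‖) ^ 2 := by ring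
        _ ≤ L * ‖x - x'‖ * (‖x‖ + ‖x'‖) * (2 * ((1 + ‖u‖ ^ 2) * (1 + ‖v‖ ^ 2))) := by
            gcongr
            exact hn u v
        _ = _ := by ring
  refine hb.trans (le_of_eq ?_)
  ring

/-- Scaling by `‖x‖` maps the fixed moment balls onto the state-dependent ones, even at `x = 0`. The
scaled payoffs vary in `x` uniformly in the laws, so the value inherits their modulus and
near-optimal laws can be frozen near points of a dense sequence. -/
theorem QuadLip.exists_stage_value {f : E × (X × Y) → ℝ} (hf : QuadLip f) {c₁ c₂ : ℝ}
    (hc₁ : 0 ≤ c₁) (hc₂ : 0 ≤ c₂) :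
    ∃ V : E → ℝ, QuadLip V ∧ ∀ ε > 0,
      (∃ κ : Kernel E X, ∀ x, κ x ∈ momentBall X (c₁ * ‖x‖ ^ 2) ∧
        ∀ ν ∈ momentBall Y (c₂ * ‖x‖ ^ 2), ∫ p, f (x, p) ∂((κ x).prod ν) ≤ V x + ε) ∧
      ∃ κ : Kernel E Y, ∀ x, κ x ∈ momentBall Y (c₂ * ‖x‖ ^ 2) ∧
        ∀ μ ∈ momentBall X (c₁ * ‖x‖ ^ 2), V x - ε ≤ ∫ p, f (x, p) ∂(μ.prod (κ x)) := by
  have hfc := hf.continuous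
  obtain ⟨L, hL, hg⟩ := hf.exists_scaled_sub_le hc₁ hc₂
  have hval : ∀ x, ∃ V : ℝ, ∀ ε > 0,
      (∃ μ ∈ momentBall X c₁, ∀ ν ∈ momentBall Y c₂,
        ∫ p, f (x, ‖x‖ • p) ∂(μ.prod ν) ≤ V + ε) ∧
      ∃ ν ∈ momentBall Y c₂, ∀ μ ∈ momentBall X c₁,
        V - ε ≤ ∫ p, f (x, ‖x‖ • p) ∂(μ.prod ν) := fun x => by
    obtain ⟨L', hL', h⟩ := hf
    refine exists_mixed_value (L := 2 * L' * ‖x‖ * ‖x‖) (by positivity) (fun w w' =>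
      (h _ _).trans ?_) hc₁ hc₂
    have h1 : ∀ w : X × Y, ‖(x, ‖x‖ • w)‖ ≤ ‖x‖ * (1 + ‖w‖) := fun w => by
      rw [Prod.norm_def]
      refine max_le ?_ ?_
      · nlinarith [norm_nonneg x, norm_nonneg w]
      · simp only [norm_smul, norm_norm]
        nlinarith [norm_nonneg x, norm_nonneg w]
    have h2 : ‖(x, ‖x‖ • w) - (x, ‖x‖ • w')‖ = ‖x‖ * ‖w - w'‖ := by
      rw [Prod.mk_sub_mk, ← smul_sub, sub_self, Prod.norm_def, norm_smul]
      simp only [norm_zero, norm_norm]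
      exact max_eq_right (by positivity)
    rw [h2]
    calc _ ≤ L' * (‖x‖ * ‖w - w'‖) * (‖x‖ * (1 + ‖w‖) + ‖x‖ * (1 + ‖w'‖)) := by
          gcongr
          · exact h1 w
          · exact h1 w'
      _ = L' * ‖x‖ * ‖x‖ * ‖w - w'‖ * (2 + ‖w‖ + ‖w'‖) := by ring
      _ ≤ L' * ‖x‖ * ‖x‖ * ‖w - w'‖ * (2 * (1 + ‖w‖ + ‖w'‖)) := by
          gcongr
          linarith [norm_nonneg w, norm_nonneg w']
      _ = _ := by ring
  choose V hV using hval
  -- Play the maximizer's near-optimal law for `x` against the minimizer's for `x'` and compare the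
  -- two payoffs of this one pair.
  have hVle : ∀ x x', V x - V x' ≤ L * ‖x - x'‖ * (‖x‖ + ‖x'‖) := fun x x' => by
    refine le_of_forall_pos_le_add fun ε hε => ?_
    obtain ⟨ν, hν, h1⟩ := (hV x _ (half_pos hε)).2
    obtain ⟨μ, hμ, h2⟩ := (hV x' _ (half_pos hε)).1
    linarith [h1 μ hμ, h2 ν hν, (abs_le.1 (hg x x' μ hμ ν hν)).2]
  refine ⟨V, ⟨L, hL, fun x x' => abs_le.2 ⟨?_, hVle x x'⟩⟩, fun ε hε => ?_⟩
  · have := hVle x' x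
    rw [norm_sub_rev, add_comm ‖x'‖] at this
    linarith
  -- Three losses of `ε / 3`: near-optimality at the dense point, the change of payoff, and the
  -- change of value between that point and `x`.
  obtain ⟨ix, hixm, hix⟩ := exists_measurable_index (E := E) (L := L) (ε := ε / 3) (by positivity)
  have : Nonempty E := ⟨0⟩
  constructor
  · choose m hm hm' using fun n => (hV (TopologicalSpace.denseSeq E n) (ε / 3) (by positivity)).1
    obtain ⟨κ, hκ⟩ := exists_kernel_smul hixm fun n => (hm n).1
    refine ⟨κ, fun x => ⟨hκ x ▸ map_smul_mem_momentBall (hm _), fun ν hν => ?_⟩⟩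
    obtain ⟨ν', hν', rfl⟩ := exists_map_smul_eq_of_mem_momentBall hc₂ hν
    have := (hm (ix x)).1
    have := hν'.1
    rw [hκ, integral_prod_map_smul (f := fun p => f (x, p)) (by fun_prop)]
    linarith [hm' (ix x) ν' hν', (abs_le.1 (hg x (TopologicalSpace.denseSeq E (ix x)) _
      (hm (ix x)) ν' hν')).2, hix x, norm_sub_rev x (TopologicalSpace.denseSeq E (ix x)) ▸
      hVle (TopologicalSpace.denseSeq E (ix x)) x]
  · choose m hm hm' using fun n => (hV (TopologicalSpace.denseSeq E n) (ε / 3) (by positivity)).2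
    obtain ⟨κ, hκ⟩ := exists_kernel_smul hixm fun n => (hm n).1
    refine ⟨κ, fun x => ⟨hκ x ▸ map_smul_mem_momentBall (hm _), fun ν hν => ?_⟩⟩
    obtain ⟨ν', hν', rfl⟩ := exists_map_smul_eq_of_mem_momentBall hc₁ hν
    have := (hm (ix x)).1
    have := hν'.1
    rw [hκ, integral_prod_map_smul (f := fun p => f (x, p)) (by fun_prop)]
    linarith [hm' (ix x) ν' hν', (abs_le.1 (hg x (TopologicalSpace.denseSeq E (ix x)) _
      hν' _ (hm (ix x)))).1, hix x, hVle x (TopologicalSpace.denseSeq E (ix x))]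

end StageValue

/-! ### The flow under constant controls and its running cost -/

section Flow

variable {d d₁ d₂ : ℕ}

theorem quadForm_eq_inner (M : Matrix (Fin d) (Fin d) ℝ) (x : RVec d) :
    quadForm M x = inner ℝ x (Matrix.toEuclideanCLM (𝕜 := ℝ) M x) :=
  (Matrix.inner_toEuclideanCLM M x x).symm

theorem abs_quadForm_sub_le (M : Matrix (Fin d) (Fin d) ℝ) (x y : RVec d) :
    |quadForm M x - quadForm M y| ≤
      ‖Matrix.toEuclideanCLM (𝕜 := ℝ) M‖ * ‖x - y‖ * (‖x‖ + ‖y‖) := by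
  simp only [quadForm_eq_inner]
  set S := Matrix.toEuclideanCLM (𝕜 := ℝ) M
  have h : inner ℝ x (S x) - inner ℝ y (S y) = inner ℝ (x - y) (S x) + inner ℝ y (S (x - y)) := by
    rw [map_sub, inner_sub_left, inner_sub_right]
    ring
  rw [h]
  calc _ ≤ ‖x - y‖ * (‖S‖ * ‖x‖) + ‖y‖ * (‖S‖ * ‖x - y‖) :=
        (abs_add_le _ _).trans (add_le_add
          ((abs_real_inner_le_norm _ _).trans (by gcongr; exact S.le_opNorm _))
          ((abs_real_inner_le_norm _ _).trans (by gcongr; exact S.le_opNorm _)))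
    _ = _ := by ring

theorem quadLip_quadForm (M : Matrix (Fin d) (Fin d) ℝ) : QuadLip (quadForm M) :=
  ⟨_, norm_nonneg _, abs_quadForm_sub_le M⟩

/-- The operator `exp (t A)`. -/
noncomputable def expFlow (A : Matrix (Fin d) (Fin d) ℝ) (t : ℝ) : RVec d →L[ℝ] RVec d :=
  Matrix.toEuclideanCLM (𝕜 := ℝ) (NormedSpace.exp (t • A))

theorem continuous_expFlow (A : Matrix (Fin d) (Fin d) ℝ) : Continuous (expFlow A) := by
  have h := LQGame.continuous_exp_smul A 0
  have h1 : Continuous fun t : ℝ => NormedSpace.exp (t • A) := by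
    have := h.comp continuous_neg
    simpa [Function.comp_def] using this
  have h2 : Continuous fun M : Matrix (Fin d) (Fin d) ℝ =>
      Matrix.toEuclideanCLM (𝕜 := ℝ) (n := Fin d) M :=
    LinearMap.continuous_of_finiteDimensional
      { toFun := Matrix.toEuclideanCLM (𝕜 := ℝ) (n := Fin d)
        map_add' := map_add _
        map_smul' := map_smul _ }
  exact h2.comp h1

theorem expFlow_zero (A : Matrix (Fin d) (Fin d) ℝ) : expFlow A 0 = 1 := by
  simp [expFlow, NormedSpace.exp_zero]

theorem expFlow_add (A : Matrix (Fin d) (Fin d) ℝ) (s t : ℝ) (x : RVec d) :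
    expFlow A (s + t) x = expFlow A s (expFlow A t x) := by
  rw [expFlow, add_smul,
    Matrix.exp_add_of_commute _ _ ((Commute.refl A).smul_left s |>.smul_right t), map_mul]
  rfl

namespace LQGame

/-- The drift `(u, v) ↦ B₁ u + B₂ v` exerted by the controls. -/
noncomputable def controlDrift (G : LQGame d d₁ d₂) : RVec d₁ × RVec d₂ →L[ℝ] RVec d :=
  (LinearMap.toContinuousLinearMap (Matrix.toEuclideanLin G.B₁)).coprod
    (LinearMap.toContinuousLinearMap (Matrix.toEuclideanLin G.B₂))

/-- The state reached after time `r` from `z.1` under the constant controls `z.2`. -/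
noncomputable def flow (G : LQGame d d₁ d₂) (r : ℝ) :
    RVec d × (RVec d₁ × RVec d₂) →L[ℝ] RVec d :=
  (expFlow G.A r).coprod ((∫ s in (0 : ℝ)..r, expFlow G.A s).comp G.controlDrift)

theorem continuous_flow (G : LQGame d d₁ d₂) : Continuous G.flow := by
  have h := continuous_expFlow G.A
  have h2 : Continuous fun r => ∫ s in (0 : ℝ)..r, expFlow G.A s :=
    intervalIntegral.continuous_primitive (fun a b => h.intervalIntegrable a b) 0
  have h3 : Continuous fun r =>
      (expFlow G.A r).comp (ContinuousLinearMap.fst ℝ (RVec d) (RVec d₁ × RVec d₂)) +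
      ((∫ s in (0 : ℝ)..r, expFlow G.A s).comp G.controlDrift).comp
        (ContinuousLinearMap.snd ℝ (RVec d) (RVec d₁ × RVec d₂)) :=
    (h.clm_comp continuous_const).add ((h2.clm_comp continuous_const).clm_comp continuous_const)
  convert h3 using 2 with r
  ext z <;> simp [flow]

theorem flow_apply (G : LQGame d d₁ d₂) (r : ℝ) (x : RVec d) (w : RVec d₁ × RVec d₂) :
    G.flow r (x, w) = expFlow G.A r x + ∫ s in (0 : ℝ)..r, expFlow G.A s (G.controlDrift w) := by
  rw [← ContinuousLinearMap.intervalIntegral_apply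
    ((continuous_expFlow G.A).intervalIntegrable 0 r)]
  simp [flow]

/-- The running cost rate at time `r` after the sampled state `z.1` under the controls `z.2`. -/
noncomputable def rate (G : LQGame d d₁ d₂) (z : RVec d × (RVec d₁ × RVec d₂)) (r : ℝ) : ℝ :=
  quadForm G.Q (G.flow r z) + quadForm G.R₁ z.2.1 - quadForm G.R₂ z.2.2

theorem continuous_rate (G : LQGame d d₁ d₂) (z : RVec d × (RVec d₁ × RVec d₂)) :
    Continuous (G.rate z) := by
  have h1 : Continuous fun r => G.flow r z := G.continuous_flow.clm_apply continuous_const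
  exact (((quadLip_quadForm G.Q).continuous.comp h1).add continuous_const).sub continuous_const

/-- The running cost of a sampling interval of length `δ`. -/
noncomputable def stageCost (G : LQGame d d₁ d₂) (δ : ℝ) (z : RVec d × (RVec d₁ × RVec d₂)) : ℝ :=
  ∫ r in (0 : ℝ)..δ, G.rate z r

/-- The flow operators are bounded in norm on the compact interval `[0, δ]`, so the increment bound
for the rate is uniform in time and can be integrated. -/
theorem quadLip_stageCost (G : LQGame d d₁ d₂) {δ : ℝ} (hδ : 0 ≤ δ) :
    QuadLip (G.stageCost δ) := by
  obtain ⟨K, hK⟩ := (isCompact_Icc (a := (0 : ℝ)) (b := δ)).exists_bound_of_continuousOn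
    G.continuous_flow.continuousOn
  have hK0 : 0 ≤ K := (norm_nonneg _).trans (hK 0 ⟨le_rfl, hδ⟩)
  set q := ‖Matrix.toEuclideanCLM (𝕜 := ℝ) G.Q‖
  set r₁ := ‖Matrix.toEuclideanCLM (𝕜 := ℝ) G.R₁‖
  set r₂ := ‖Matrix.toEuclideanCLM (𝕜 := ℝ) G.R₂‖
  refine ⟨(q * K * K + r₁ + r₂) * δ, by positivity, fun z z' => ?_⟩
  rw [stageCost, stageCost, ← intervalIntegral.integral_sub
    ((G.continuous_rate z).intervalIntegrable _ _) ((G.continuous_rate z').intervalIntegrable _ _)]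
  have hb : ∀ r ∈ Set.uIoc 0 δ, ‖G.rate z r - G.rate z' r‖ ≤
      (q * K * K + r₁ + r₂) * ‖z - z'‖ * (‖z‖ + ‖z'‖) := fun r hr => by
    rw [Set.uIoc_of_le hδ] at hr
    have hKr := hK r ⟨hr.1.le, hr.2⟩
    have hle : ∀ y, ‖G.flow r y‖ ≤ K * ‖y‖ := fun y =>
      ((G.flow r).le_opNorm y).trans (by gcongr)
    have h1 : |quadForm G.Q (G.flow r z) - quadForm G.Q (G.flow r z')| ≤
        q * (K * ‖z - z'‖) * (K * ‖z‖ + K * ‖z'‖) := by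
      refine (abs_quadForm_sub_le _ _ _).trans ?_
      rw [← map_sub]
      gcongr <;> exact hle _
    have h21 : ∀ y : RVec d × (RVec d₁ × RVec d₂), ‖y.2.1‖ ≤ ‖y‖ := fun y =>
      (norm_fst_le y.2).trans (norm_snd_le y)
    have h22 : ∀ y : RVec d × (RVec d₁ × RVec d₂), ‖y.2.2‖ ≤ ‖y‖ := fun y =>
      (norm_snd_le y.2).trans (norm_snd_le y)
    have h2 : |quadForm G.R₁ z.2.1 - quadForm G.R₁ z'.2.1| ≤ r₁ * ‖z - z'‖ * (‖z‖ + ‖z'‖) :=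
      (abs_quadForm_sub_le _ _ _).trans (by
        gcongr
        exacts [h21 (z - z'), h21 z, h21 z'])
    have h3 : |quadForm G.R₂ z.2.2 - quadForm G.R₂ z'.2.2| ≤ r₂ * ‖z - z'‖ * (‖z‖ + ‖z'‖) :=
      (abs_quadForm_sub_le _ _ _).trans (by
        gcongr
        exacts [h22 (z - z'), h22 z, h22 z'])
    rw [abs_le] at h1 h2 h3
    rw [Real.norm_eq_abs, abs_le, rate, rate]
    constructor <;> linarith [h1.1, h1.2, h2.1, h2.2, h3.1, h3.2]
  refine (intervalIntegral.norm_integral_le_of_norm_le_const hb).trans (le_of_eq ?_)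
  rw [sub_zero, abs_of_nonneg hδ]
  ring

end LQGame

end Flow

namespace LQGame

/-! ### Causality and the stagewise decomposition of state and cost -/

section Dynamics

variable {d d₁ d₂ N : ℕ} {t₀ T : ℝ} (G : LQGame d d₁ d₂) (π : SamplingPartition t₀ T N)
  (x₀ : RVec d)

theorem signal_of_mem (ω : Actions d₁ d₂ N) (k : Fin N) {s : ℝ}
    (hs : s ∈ Set.Ico (π.τ k.castSucc) (π.τ k.succ)) : signal π ω s = ω k := by
  rw [signal, Finset.sum_eq_single k]
  · rw [Set.indicator_of_mem hs]
  · intro j _ hj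
    refine Set.indicator_of_notMem (fun hsj => ?_) _
    rcases lt_or_gt_of_ne hj with h | h
    · have := π.strictMono.monotone (Fin.succ_le_castSucc_iff.2 h)
      linarith [hs.1, hsj.2]
    · have := π.strictMono.monotone (Fin.succ_le_castSucc_iff.2 h)
      linarith [hs.2, hsj.1]
  · simp

theorem signal_update_of_lt (ω : Actions d₁ d₂ N) (k : Fin N) (w : RVec d₁ × RVec d₂) {s : ℝ}
    (hs : s < π.τ k.castSucc) : signal π (Function.update ω k w) s = signal π ω s := by
  refine Finset.sum_congr rfl fun j _ => ?_
  rcases eq_or_ne j k with rfl | hj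
  · have : s ∉ Set.Ico (π.τ j.castSucc) (π.τ j.succ) := fun h => absurd h.1 (not_le.2 hs)
    rw [Set.indicator_of_notMem this, Set.indicator_of_notMem this]
  · rw [Function.update_of_ne hj]

theorem first_le (k : Fin (N + 1)) : t₀ ≤ π.τ k :=
  π.first.symm.le.trans (π.strictMono.monotone (Fin.zero_le k))

theorem state_eq (ω : Actions d₁ d₂ N) (t : ℝ) : G.state π x₀ ω t =
    expFlow G.A (t - t₀) x₀ +
      ∫ s in t₀..t, expFlow G.A (t - s) (G.controlDrift (signal π ω s)) := rfl

theorem intervalIntegrable_clm_signal {F : ℝ → RVec d →L[ℝ] RVec d} (hF : Continuous F)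
    (ω : Actions d₁ d₂ N) (a b : ℝ) :
    IntervalIntegrable (fun s => F s (G.controlDrift (signal π ω s))) volume a b := by
  have h : (fun s => F s (G.controlDrift (signal π ω s))) = fun s => ∑ k : Fin N,
      (Set.Ico (π.τ k.castSucc) (π.τ k.succ)).indicator
        (fun s => F s (G.controlDrift (ω k))) s := by
    ext1 s
    rw [signal, map_sum, map_sum]
    refine Finset.sum_congr rfl fun k _ => ?_
    by_cases hs : s ∈ Set.Ico (π.τ k.castSucc) (π.τ k.succ) <;> simp [hs]
  rw [h, intervalIntegrable_iff]
  refine integrable_finsetSum _ fun k _ => Integrable.indicator ?_ measurableSet_Ico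
  have : Continuous fun s => F s (G.controlDrift (ω k)) := hF.clm_apply continuous_const
  exact intervalIntegrable_iff.1 (this.intervalIntegrable a b)

theorem state_first (ω : Actions d₁ d₂ N) : G.state π x₀ ω t₀ = x₀ := by
  simp [state_eq, expFlow_zero]

/-- Causality, including the instant `τ k` itself: the new action can change the integrand there
only at a single, negligible time. -/
theorem state_update_of_le (ω : Actions d₁ d₂ N) (k : Fin N) (w : RVec d₁ × RVec d₂) {t : ℝ}
    (h0 : t₀ ≤ t) (ht : t ≤ π.τ k.castSucc) :
    G.state π x₀ (Function.update ω k w) t = G.state π x₀ ω t := by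
  rw [state_eq, state_eq]
  congr 1
  refine intervalIntegral.integral_congr_ae ?_
  filter_upwards [compl_mem_ae_iff.2 (measure_singleton t)] with s hs hs'
  rw [Set.uIoc_of_le h0] at hs'
  rw [signal_update_of_lt π ω k w ((lt_of_le_of_ne hs'.2 hs).trans_le ht)]

/-- The semigroup law for the exponential restarts variation of constants at `τ k`. The right
endpoint is allowed although the signal has already switched there, since one point is null. -/
theorem state_of_mem (ω : Actions d₁ d₂ N) (k : Fin N) {t : ℝ}
    (ht : t ∈ Set.Icc (π.τ k.castSucc) (π.τ k.succ)) : G.state π x₀ ω t =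
      G.flow (t - π.τ k.castSucc) (G.state π x₀ ω (π.τ k.castSucc), ω k) := by
  have hc := continuous_expFlow G.A
  have hint : ∀ r a b, IntervalIntegrable
      (fun s => expFlow G.A (r - s) (G.controlDrift (signal π ω s))) volume a b := fun r a b =>
    G.intervalIntegrable_clm_signal π (F := fun s => expFlow G.A (r - s)) (by fun_prop) ω a b
  have hsplit : ∀ s x, expFlow G.A (t - s) x =
      expFlow G.A (t - π.τ k.castSucc) (expFlow G.A (π.τ k.castSucc - s) x) := fun s x => by
    rw [← expFlow_add]
    congr 2
    ring
  rw [flow_apply, state_eq, state_eq, map_add, ← hsplit, add_assoc,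
    ← intervalIntegral.integral_add_adjacent_intervals (hint t t₀ (π.τ k.castSucc))
      (hint t (π.τ k.castSucc) t),
    ← ContinuousLinearMap.intervalIntegral_comp_comm _ (hint _ _ _)]
  simp only [← hsplit]
  congr 2
  have h := intervalIntegral.integral_comp_sub_left (a := π.τ k.castSucc) (b := t)
    (fun s => expFlow G.A s (G.controlDrift (ω k))) t
  rw [sub_self] at h
  rw [← h]
  refine intervalIntegral.integral_congr_ae ?_
  filter_upwards [compl_mem_ae_iff.2 (measure_singleton t)] with s hs hs'
  rw [Set.uIoc_of_le ht.1] at hs'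
  rw [signal_of_mem π ω k ⟨hs'.1.le, (lt_of_le_of_ne hs'.2 hs).trans_le ht.2⟩]

/-- The running cost rate at time `t`. -/
noncomputable def costRate (ω : Actions d₁ d₂ N) (t : ℝ) : ℝ :=
  quadForm G.Q (G.state π x₀ ω t) + quadForm G.R₁ (signal π ω t).1 - quadForm G.R₂ (signal π ω t).2

/-- The running cost up to the `k`-th sampling instant. -/
noncomputable def runCost (k : Fin (N + 1)) (ω : Actions d₁ d₂ N) : ℝ :=
  ∫ t in t₀..π.τ k, G.costRate π x₀ ω t

theorem cost_eq (ω : Actions d₁ d₂ N) : G.cost π x₀ ω =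
    G.runCost π x₀ (Fin.last N) ω + quadForm G.QT (G.state π x₀ ω (π.τ (Fin.last N))) := by
  rw [runCost, π.last]
  rfl

theorem runCost_zero (ω : Actions d₁ d₂ N) : G.runCost π x₀ 0 ω = 0 := by
  rw [runCost, π.first, intervalIntegral.integral_same]

theorem runCost_update (ω : Actions d₁ d₂ N) (k : Fin N) (w : RVec d₁ × RVec d₂) :
    G.runCost π x₀ k.castSucc (Function.update ω k w) = G.runCost π x₀ k.castSucc ω := by
  refine intervalIntegral.integral_congr_ae ?_
  filter_upwards [compl_mem_ae_iff.2 (measure_singleton (π.τ k.castSucc))] with s hs hs'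
  rw [Set.uIoc_of_le (first_le π _)] at hs'
  rw [costRate, costRate, signal_update_of_lt π ω k w (lt_of_le_of_ne hs'.2 hs),
    G.state_update_of_le π x₀ ω k w hs'.1.le hs'.2]

theorem costRate_ae_eq (ω : Actions d₁ d₂ N) (k : Fin N) :
    ∀ᵐ t ∂volume, t ∈ Set.uIoc (π.τ k.castSucc) (π.τ k.succ) →
      G.costRate π x₀ ω t =
        G.rate (G.state π x₀ ω (π.τ k.castSucc), ω k) (t - π.τ k.castSucc) := by
  filter_upwards [compl_mem_ae_iff.2 (measure_singleton (π.τ k.succ))] with s hs hs'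
  rw [Set.uIoc_of_le (π.strictMono.monotone k.castSucc_le_succ)] at hs'
  rw [costRate, rate, signal_of_mem π ω k ⟨hs'.1.le, lt_of_le_of_ne hs'.2 hs⟩,
    G.state_of_mem π x₀ ω k ⟨hs'.1.le, hs'.2⟩]

theorem intervalIntegrable_costRate_stage (ω : Actions d₁ d₂ N) (k : Fin N) :
    IntervalIntegrable (G.costRate π x₀ ω) volume (π.τ k.castSucc) (π.τ k.succ) := by
  have h : IntervalIntegrable (fun t => G.rate (G.state π x₀ ω (π.τ k.castSucc), ω k)
      (t - π.τ k.castSucc)) volume (π.τ k.castSucc) (π.τ k.succ) :=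
    ((G.continuous_rate _).comp (by fun_prop)).intervalIntegrable _ _
  refine h.congr_ae ?_
  rw [Filter.EventuallyEq, ae_restrict_iff' measurableSet_uIoc]
  filter_upwards [G.costRate_ae_eq π x₀ ω k] with t ht hmem using (ht hmem).symm

theorem intervalIntegrable_costRate (ω : Actions d₁ d₂ N) (k : Fin (N + 1)) :
    IntervalIntegrable (G.costRate π x₀ ω) volume t₀ (π.τ k) := by
  induction k using Fin.induction with
  | zero => rw [π.first]
  | succ k ih => exact ih.trans (G.intervalIntegrable_costRate_stage π x₀ ω k)

theorem runCost_succ (ω : Actions d₁ d₂ N) (k : Fin N) :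
    G.runCost π x₀ k.succ ω = G.runCost π x₀ k.castSucc ω +
      G.stageCost (π.τ k.succ - π.τ k.castSucc) (G.state π x₀ ω (π.τ k.castSucc), ω k) := by
  rw [runCost, runCost, ← intervalIntegral.integral_add_adjacent_intervals
    (G.intervalIntegrable_costRate π x₀ ω k.castSucc)
    (G.intervalIntegrable_costRate_stage π x₀ ω k),
    intervalIntegral.integral_congr_ae (G.costRate_ae_eq π x₀ ω k), stageCost,
    intervalIntegral.integral_comp_sub_right (fun r => G.rate _ r)]
  simp

end Dynamics

end LQGame

namespace LQGame

/-! ### The law of the play, one stage at a time -/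

section Law

variable {d d₁ d₂ N : ℕ} {t₀ T : ℝ} (G : LQGame d d₁ d₂) (π : SamplingPartition t₀ T N)
  (x₀ : RVec d) (α : MixedStrategy d d₁ N G.γ₁) (β : MixedStrategy d d₂ N G.γ₂)

/-- The joint law of the two actions at the `k`-th sampling instant in the state `x`. -/
noncomputable def actionLaw {G : LQGame d d₁ d₂} (α : MixedStrategy d d₁ N G.γ₁)
    (β : MixedStrategy d d₂ N G.γ₂) (k : Fin N) (x : RVec d) : Measure (RVec d₁ × RVec d₂) :=
  (α.kernel k x).prod (β.kernel k x)

theorem kernel_mem_momentBall {m : ℕ} {γ : ℝ} (α : MixedStrategy d m N γ) (k : Fin N)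
    (x : RVec d) : α.kernel k x ∈ momentBall (RVec m) (γ ^ 2 * ‖x‖ ^ 2) :=
  have := α.markov k
  ⟨inferInstance, α.energy k x⟩

theorem stage_apply (k : Fin N) (ω : Actions d₁ d₂ N) : G.stage π x₀ α β k ω =
    (actionLaw α β k (G.state π x₀ ω (π.τ k.castSucc))).map (Function.update ω k) := by
  have := α.markov k
  have := β.markov k
  have h : Measurable fun p : Actions d₁ d₂ N × (RVec d₁ × RVec d₂) =>
      Function.update p.1 k p.2 := measurable_update'
  rw [stage, Kernel.map_apply _ h, Kernel.prod_apply, Kernel.id_apply, Kernel.comap_apply,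
    Kernel.prod_apply, Measure.dirac_prod, Measure.map_map h (by fun_prop)]
  rfl

theorem isMarkovKernel_stage (k : Fin N) : IsMarkovKernel (G.stage π x₀ α β k) := by
  have := α.markov k
  have := β.markov k
  exact Kernel.IsMarkovKernel.map _ measurable_update'

theorem lawUpTo_zero : G.lawUpTo π x₀ α β 0 = Measure.dirac 0 := rfl

theorem lawUpTo_succ (k : Fin N) : G.lawUpTo π x₀ α β k.succ =
    (G.lawUpTo π x₀ α β k.castSucc).bind (G.stage π x₀ α β k) := rfl

theorem isProbabilityMeasure_lawUpTo (k : Fin (N + 1)) :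
    IsProbabilityMeasure (G.lawUpTo π x₀ α β k) := by
  induction k using Fin.induction with
  | zero => rw [lawUpTo_zero]; infer_instance
  | succ k ih =>
    have := G.isMarkovKernel_stage π x₀ α β k
    rw [lawUpTo_succ]
    infer_instance

theorem integral_stage (k : Fin N) {F : Actions d₁ d₂ N → ℝ} (hF : Measurable F)
    (ω : Actions d₁ d₂ N) : ∫ ω', F ω' ∂(G.stage π x₀ α β k ω) =
      ∫ w, F (Function.update ω k w) ∂(actionLaw α β k (G.state π x₀ ω (π.τ k.castSucc))) := by
  rw [stage_apply, integral_map (measurable_update ω).aemeasurable hF.aestronglyMeasurable]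

theorem integrable_stage_iff (k : Fin N) {F : Actions d₁ d₂ N → ℝ} (hF : Measurable F)
    (ω : Actions d₁ d₂ N) : Integrable F (G.stage π x₀ α β k ω) ↔
      Integrable (fun w => F (Function.update ω k w))
        (actionLaw α β k (G.state π x₀ ω (π.τ k.castSucc))) := by
  rw [stage_apply, integrable_map_measure hF.aestronglyMeasurable
    (measurable_update ω).aemeasurable]
  rfl

theorem integral_lawUpTo_succ (k : Fin N) {F : Actions d₁ d₂ N → ℝ} (hF : Measurable F)
    (hi : Integrable F (G.lawUpTo π x₀ α β k.succ)) :
    ∫ ω, F ω ∂(G.lawUpTo π x₀ α β k.succ) = ∫ ω, ∫ w, F (Function.update ω k w)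
      ∂(actionLaw α β k (G.state π x₀ ω (π.τ k.castSucc)))
        ∂(G.lawUpTo π x₀ α β k.castSucc) := by
  rw [lawUpTo_succ, Measure.comp_eq_comp_const_apply] at hi ⊢
  rw [ProbabilityTheory.Kernel.integral_comp hi]
  simp only [Kernel.const_apply, G.integral_stage π x₀ α β k hF]

theorem integrable_integral_actionLaw (k : Fin N) {F : Actions d₁ d₂ N → ℝ} (hF : Measurable F)
    (hi : Integrable F (G.lawUpTo π x₀ α β k.succ)) :
    Integrable (fun ω => ∫ w, F (Function.update ω k w)
      ∂(actionLaw α β k (G.state π x₀ ω (π.τ k.castSucc)))) (G.lawUpTo π x₀ α β k.castSucc) := by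
  rw [lawUpTo_succ, Measure.comp_eq_comp_const_apply] at hi
  simpa only [Kernel.const_apply, G.integral_stage π x₀ α β k hF] using hi.integral_comp

theorem state_succ_update (k : Fin N) (ω : Actions d₁ d₂ N) (w : RVec d₁ × RVec d₂) :
    G.state π x₀ (Function.update ω k w) (π.τ k.succ) =
      G.flow (π.τ k.succ - π.τ k.castSucc) (G.state π x₀ ω (π.τ k.castSucc), w) := by
  rw [G.state_of_mem π x₀ _ k ⟨π.strictMono.monotone k.castSucc_le_succ, le_rfl⟩,
    G.state_update_of_le π x₀ ω k w (first_le π _) le_rfl, Function.update_self]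

theorem runCost_succ_update (k : Fin N) (ω : Actions d₁ d₂ N) (w : RVec d₁ × RVec d₂) :
    G.runCost π x₀ k.succ (Function.update ω k w) = G.runCost π x₀ k.castSucc ω +
      G.stageCost (π.τ k.succ - π.τ k.castSucc) (G.state π x₀ ω (π.τ k.castSucc), w) := by
  rw [runCost_succ, runCost_update, G.state_update_of_le π x₀ ω k w (first_le π _) le_rfl,
    Function.update_self]

/-- The payoff of the `k`-th stage, when `f` is the payoff from the next sampling instant on. -/
noncomputable def stagePayoff (k : Fin N) (f : RVec d → ℝ) (z : RVec d × (RVec d₁ × RVec d₂)) :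
    ℝ :=
  G.stageCost (π.τ k.succ - π.τ k.castSucc) z + f (G.flow (π.τ k.succ - π.τ k.castSucc) z)

theorem quadLip_stageCost_partition (k : Fin N) :
    QuadLip (G.stageCost (π.τ k.succ - π.τ k.castSucc)) :=
  G.quadLip_stageCost (sub_nonneg.2 (π.strictMono.monotone k.castSucc_le_succ))

theorem quadLip_stagePayoff (k : Fin N) {f : RVec d → ℝ} (hf : QuadLip f) :
    QuadLip (G.stagePayoff π k f) :=
  (G.quadLip_stageCost_partition π k).add (hf.comp _)

/-- The stage recursion expresses the cost as a finite sum of continuous functions of sampled states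
and actions. -/
theorem measurable_runCost (k : Fin (N + 1)) : Measurable (G.runCost π x₀ k) := by
  induction k using Fin.induction with
  | zero => simp only [funext (G.runCost_zero π x₀)]; exact measurable_const
  | succ k ih =>
    simp only [funext fun ω => G.runCost_succ π x₀ ω k]
    exact ih.add ((G.quadLip_stageCost_partition π k).continuous.measurable.comp
      ((G.measurable_state π x₀ _).prodMk (measurable_pi_apply k)))

/-- The cost up to the `k`-th sampling instant plus the payoff `f` of the state there. -/
noncomputable def costTo (k : Fin (N + 1)) (f : RVec d → ℝ) (ω : Actions d₁ d₂ N) : ℝ :=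
  G.runCost π x₀ k ω + f (G.state π x₀ ω (π.τ k))

theorem measurable_costTo (k : Fin (N + 1)) {f : RVec d → ℝ} (hf : QuadLip f) :
    Measurable (G.costTo π x₀ k f) :=
  (G.measurable_runCost π x₀ k).add (hf.continuous.measurable.comp (G.measurable_state π x₀ _))

theorem costTo_succ_update (k : Fin N) (f : RVec d → ℝ) (ω : Actions d₁ d₂ N)
    (w : RVec d₁ × RVec d₂) : G.costTo π x₀ k.succ f (Function.update ω k w) =
      G.runCost π x₀ k.castSucc ω +
        G.stagePayoff π k f (G.state π x₀ ω (π.τ k.castSucc), w) := by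
  rw [costTo, runCost_succ_update, state_succ_update, stagePayoff, add_assoc]

theorem exists_abs_stagePayoff_le (k : Fin N) {f : RVec d → ℝ} (hf : QuadLip f) :
    ∃ C, 0 ≤ C ∧ ∀ x w, |G.stagePayoff π k f (x, w)| ≤
      C * (1 + ‖x‖ ^ 2 + ‖w.1‖ ^ 2 + ‖w.2‖ ^ 2) := by
  obtain ⟨C, hC0, hC⟩ := (G.quadLip_stagePayoff π k hf).exists_abs_le
  refine ⟨C, hC0, fun x w => (hC _).trans ?_⟩
  gcongr C * ?_
  have h : ‖(x, w)‖ ^ 2 ≤ ‖x‖ ^ 2 + ‖w.1‖ ^ 2 + ‖w.2‖ ^ 2 := by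
    rw [Prod.norm_def, Prod.norm_def]
    have h1 := sq_nonneg ‖x‖
    have h2 := sq_nonneg ‖w.1‖
    have h3 := sq_nonneg ‖w.2‖
    rcases max_choice ‖x‖ (max ‖w.1‖ ‖w.2‖) with h | h <;> simp only [h]
    · linarith
    · rcases max_choice ‖w.1‖ ‖w.2‖ with h | h <;> rw [h] <;> linarith
  linarith

/-! ### Integrability of the cost -/

theorem integrable_stagePayoff (k : Fin N) {f : RVec d → ℝ} (hf : QuadLip f) (x : RVec d) :
    Integrable (fun w => G.stagePayoff π k f (x, w)) (actionLaw α β k x) := by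
  have := α.markov k
  have := β.markov k
  have hc := (G.quadLip_stagePayoff π k hf).continuous
  obtain ⟨C, -, hC⟩ := G.exists_abs_stagePayoff_le π k hf
  refine Integrable.mono' (((integrable_const (1 + ‖x‖ ^ 2)).add
    ((integrable_sq_norm_of_mem_momentBall (kernel_mem_momentBall α k x)).comp_fst
      (β.kernel k x))).add ((integrable_sq_norm_of_mem_momentBall
        (kernel_mem_momentBall β k x)).comp_snd (α.kernel k x)) |>.const_mul C)
    (by fun_prop) (Filter.Eventually.of_forall fun w => hC x w)

/-- The energy constraints turn the actions' second moments into multiples of `‖x‖²`. The bound thus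
involves the state alone, which lets integrability propagate. -/
theorem exists_integral_abs_stagePayoff_le (k : Fin N) {f : RVec d → ℝ} (hf : QuadLip f) :
    ∃ C, ∀ x, ∫ w, |G.stagePayoff π k f (x, w)| ∂(actionLaw α β k x) ≤ C * (1 + ‖x‖ ^ 2) := by
  have := α.markov k
  have := β.markov k
  obtain ⟨C, hC0, hC⟩ := G.exists_abs_stagePayoff_le π k hf
  refine ⟨C * (1 + G.γ₁ ^ 2 + G.γ₂ ^ 2), fun x => ?_⟩
  have hα := kernel_mem_momentBall α k x
  have hβ := kernel_mem_momentBall β k x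
  have h1 := (integrable_sq_norm_of_mem_momentBall hα).comp_fst (β.kernel k x)
  have h2 := (integrable_sq_norm_of_mem_momentBall hβ).comp_snd (α.kernel k x)
  have h3 := (integrable_const (μ := (α.kernel k x).prod (β.kernel k x)) (1 + ‖x‖ ^ 2)).add h1
  have hα' := integral_sq_norm_le_of_mem_momentBall (by positivity) hα
  have hβ' := integral_sq_norm_le_of_mem_momentBall (by positivity) hβ
  calc _ ≤ ∫ w : RVec d₁ × RVec d₂, C * (1 + ‖x‖ ^ 2 + ‖w.1‖ ^ 2 + ‖w.2‖ ^ 2)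
        ∂((α.kernel k x).prod (β.kernel k x)) :=
        integral_mono (G.integrable_stagePayoff π α β k hf x).abs ((h3.add h2).const_mul C)
          fun w => hC x w
    _ = C * (1 + ‖x‖ ^ 2 + ∫ u, ‖u‖ ^ 2 ∂(α.kernel k x) + ∫ v, ‖v‖ ^ 2 ∂(β.kernel k x)) := by
        rw [integral_const_mul]
        congr 1
        refine (integral_add h3 h2).trans ?_
        rw [integral_fun_snd (fun v : RVec d₂ => ‖v‖ ^ 2)]
        congr 1
        · refine (integral_add (integrable_const _) h1).trans ?_
          rw [integral_fun_fst (fun u : RVec d₁ => ‖u‖ ^ 2)]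
          simp
        · simp
    _ ≤ C * (1 + ‖x‖ ^ 2 + G.γ₁ ^ 2 * ‖x‖ ^ 2 + G.γ₂ ^ 2 * ‖x‖ ^ 2) := by gcongr
    _ ≤ C * ((1 + G.γ₁ ^ 2 + G.γ₂ ^ 2) * (1 + ‖x‖ ^ 2)) := by
        gcongr
        nlinarith [sq_nonneg G.γ₁, sq_nonneg G.γ₂]
    _ = _ := by ring

theorem integrable_costTo_succ (k : Fin N)
    (hr : Integrable (G.runCost π x₀ k.castSucc) (G.lawUpTo π x₀ α β k.castSucc))
    (hs : Integrable (fun ω => ‖G.state π x₀ ω (π.τ k.castSucc)‖ ^ 2)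
      (G.lawUpTo π x₀ α β k.castSucc)) {f : RVec d → ℝ} (hf : QuadLip f) :
    Integrable (G.costTo π x₀ k.succ f) (G.lawUpTo π x₀ α β k.succ) := by
  have hP := G.isProbabilityMeasure_lawUpTo π x₀ α β k.castSucc
  have := α.markov k
  have := β.markov k
  have hprob : ∀ x, IsProbabilityMeasure (actionLaw α β k x) := fun x => by
    unfold actionLaw
    infer_instance
  have hm := G.measurable_costTo π x₀ k.succ hf
  have hst := fun x => G.integrable_stagePayoff π α β k hf x
  have hint : ∀ ω, Integrable (fun w => G.costTo π x₀ k.succ f (Function.update ω k w))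
      (actionLaw α β k (G.state π x₀ ω (π.τ k.castSucc))) := fun ω => by
    simp only [costTo_succ_update]
    exact (integrable_const _).add (hst _)
  obtain ⟨C, hC⟩ := G.exists_integral_abs_stagePayoff_le π α β k hf
  rw [lawUpTo_succ, Measure.integrable_comp_iff hm.aestronglyMeasurable]
  refine ⟨Filter.Eventually.of_forall fun ω => (G.integrable_stage_iff π x₀ α β k hm ω).2 (hint ω),
    ?_⟩
  refine Integrable.mono' (hr.abs.add (((integrable_const 1).add hs).const_mul C))
    (hm.stronglyMeasurable.norm.integral_kernel).aestronglyMeasurable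
    (Filter.Eventually.of_forall fun ω => ?_)
  rw [G.integral_stage π x₀ α β k hm.norm,
    Real.norm_of_nonneg (integral_nonneg fun _ => norm_nonneg _)]
  refine le_trans ?_ (add_le_add le_rfl (hC _))
  have hi := (integrable_const (μ := actionLaw α β k (G.state π x₀ ω (π.τ k.castSucc)))
    |G.runCost π x₀ k.castSucc ω|).add (hst (G.state π x₀ ω (π.τ k.castSucc))).abs
  refine (integral_mono (hint ω).norm hi fun w => ?_).trans (le_of_eq ?_)
  · simp only [costTo_succ_update]
    exact abs_add_le _ _
  · refine (integral_add (integrable_const _) (hst _).abs).trans ?_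
    simp

theorem quadLip_zero : QuadLip fun _ : RVec d => (0 : ℝ) :=
  ⟨0, le_rfl, by simp⟩

theorem quadLip_sq_norm : QuadLip fun x : RVec d => ‖x‖ ^ 2 :=
  ⟨1, zero_le_one, fun x y => by
    rw [one_mul, sq_sub_sq, abs_mul, abs_of_nonneg (by positivity), mul_comm]
    gcongr
    exact abs_norm_sub_norm_le x y⟩

theorem integrable_runCost_and_sq_norm (k : Fin (N + 1)) :
    Integrable (G.runCost π x₀ k) (G.lawUpTo π x₀ α β k) ∧
      Integrable (fun ω => ‖G.state π x₀ ω (π.τ k)‖ ^ 2) (G.lawUpTo π x₀ α β k) := by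
  induction k using Fin.induction with
  | zero =>
    rw [lawUpTo_zero, π.first]
    simp only [state_first, funext (G.runCost_zero π x₀)]
    exact ⟨integrable_const _, integrable_const _⟩
  | succ k ih =>
    -- Terminal payoff `0` yields the running cost; terminal payoff `‖·‖²` minus this yields the
    -- squared state. The next stage needs both.
    have h0 := G.integrable_costTo_succ π x₀ α β k ih.1 ih.2 quadLip_zero
    have h1 := G.integrable_costTo_succ π x₀ α β k ih.1 ih.2 quadLip_sq_norm
    exact ⟨h0.congr (Filter.Eventually.of_forall fun ω => add_zero _),
      (h1.sub h0).congr (Filter.Eventually.of_forall fun ω => by simp [costTo])⟩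

theorem integrable_costTo (k : Fin (N + 1)) {f : RVec d → ℝ} (hf : QuadLip f) :
    Integrable (G.costTo π x₀ k f) (G.lawUpTo π x₀ α β k) := by
  have hP := G.isProbabilityMeasure_lawUpTo π x₀ α β k
  obtain ⟨h1, h2⟩ := G.integrable_runCost_and_sq_norm π x₀ α β k
  obtain ⟨C, -, hC⟩ := hf.exists_abs_le
  exact h1.add ((((integrable_const 1).add h2).const_mul C).mono'
    (hf.continuous.measurable.comp (G.measurable_state π x₀ _)).aestronglyMeasurable
    (Filter.Eventually.of_forall fun ω => hC _))

/-! ### Dynamic programming -/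

theorem integral_costTo_zero (f : RVec d → ℝ) (hf : QuadLip f) :
    ∫ ω, G.costTo π x₀ 0 f ω ∂(G.lawUpTo π x₀ α β 0) = f x₀ := by
  rw [lawUpTo_zero, integral_dirac' _ _ (G.measurable_costTo π x₀ 0 hf).stronglyMeasurable, costTo,
    runCost_zero, π.first, state_first, zero_add]

theorem J_eq : G.J π x₀ α β = ∫ ω, G.costTo π x₀ (Fin.last N) (quadForm G.QT) ω
    ∂(G.lawUpTo π x₀ α β (Fin.last N)) :=
  integral_congr_ae (Filter.Eventually.of_forall fun ω => G.cost_eq π x₀ ω)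

/-- Conditioning the expected cost on the past of the `k`-th sampling instant. -/
theorem integral_costTo_succ (k : Fin N) {f : RVec d → ℝ} (hf : QuadLip f) :
    Integrable (fun ω => G.runCost π x₀ k.castSucc ω +
        ∫ w, G.stagePayoff π k f (G.state π x₀ ω (π.τ k.castSucc), w)
          ∂(actionLaw α β k (G.state π x₀ ω (π.τ k.castSucc))))
        (G.lawUpTo π x₀ α β k.castSucc) ∧
      ∫ ω, G.costTo π x₀ k.succ f ω ∂(G.lawUpTo π x₀ α β k.succ) =
      ∫ ω, (G.runCost π x₀ k.castSucc ω +
        ∫ w, G.stagePayoff π k f (G.state π x₀ ω (π.τ k.castSucc), w)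
          ∂(actionLaw α β k (G.state π x₀ ω (π.τ k.castSucc))))
        ∂(G.lawUpTo π x₀ α β k.castSucc) := by
  have := α.markov k
  have := β.markov k
  have hprob : ∀ x, IsProbabilityMeasure (actionLaw α β k x) := fun x => by
    unfold actionLaw
    infer_instance
  have h : ∀ ω, ∫ w, G.costTo π x₀ k.succ f (Function.update ω k w)
      ∂(actionLaw α β k (G.state π x₀ ω (π.τ k.castSucc))) = G.runCost π x₀ k.castSucc ω +
        ∫ w, G.stagePayoff π k f (G.state π x₀ ω (π.τ k.castSucc), w)
          ∂(actionLaw α β k (G.state π x₀ ω (π.τ k.castSucc))) := fun ω => by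
    simp only [costTo_succ_update]
    rw [integral_add (integrable_const _) (G.integrable_stagePayoff π α β k hf _)]
    simp
  have hm := G.measurable_costTo π x₀ k.succ hf
  have hi := G.integrable_costTo π x₀ α β k.succ hf
  have h1 := G.integrable_integral_actionLaw π x₀ α β k hm hi
  have h2 := G.integral_lawUpTo_succ π x₀ α β k hm hi
  simp only [h] at h1 h2
  exact ⟨h1, h2⟩

/-- The stage inequality holds at every state, so it integrates against whatever law the past has
produced; the loss `ε` is not amplified because that law is a probability. -/
theorem integral_costTo_succ_le (k : Fin N) {f V : RVec d → ℝ} (hf : QuadLip f) (hV : QuadLip V)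
    {ε : ℝ} (h : ∀ x, ∫ w, G.stagePayoff π k f (x, w) ∂(actionLaw α β k x) ≤ V x + ε) :
    ∫ ω, G.costTo π x₀ k.succ f ω ∂(G.lawUpTo π x₀ α β k.succ) ≤
      ∫ ω, G.costTo π x₀ k.castSucc V ω ∂(G.lawUpTo π x₀ α β k.castSucc) + ε := by
  have hP := G.isProbabilityMeasure_lawUpTo π x₀ α β k.castSucc
  obtain ⟨h1, h2⟩ := G.integral_costTo_succ π x₀ α β k hf
  have hi := G.integrable_costTo π x₀ α β k.castSucc hV
  rw [h2]
  refine (integral_mono h1 (hi.add (integrable_const ε)) fun ω => ?_).trans (le_of_eq ?_)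
  · simp only [costTo, Pi.add_apply]
    linarith [h (G.state π x₀ ω (π.τ k.castSucc))]
  · refine (integral_add hi (integrable_const ε)).trans ?_
    simp

theorem le_integral_costTo_succ (k : Fin N) {f V : RVec d → ℝ} (hf : QuadLip f) (hV : QuadLip V)
    {ε : ℝ} (h : ∀ x, V x - ε ≤ ∫ w, G.stagePayoff π k f (x, w) ∂(actionLaw α β k x)) :
    ∫ ω, G.costTo π x₀ k.castSucc V ω ∂(G.lawUpTo π x₀ α β k.castSucc) - ε ≤
      ∫ ω, G.costTo π x₀ k.succ f ω ∂(G.lawUpTo π x₀ α β k.succ) := by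
  have hP := G.isProbabilityMeasure_lawUpTo π x₀ α β k.castSucc
  obtain ⟨h1, h2⟩ := G.integral_costTo_succ π x₀ α β k hf
  have hi := G.integrable_costTo π x₀ α β k.castSucc hV
  rw [h2]
  refine (le_of_eq ?_).trans (integral_mono (hi.sub (integrable_const ε)) h1 fun ω => ?_)
  · refine Eq.trans ?_ (integral_sub hi (integrable_const ε)).symm
    simp
  · simp only [costTo, Pi.sub_apply]
    linarith [h (G.state π x₀ ω (π.τ k.castSucc))]

/-- The value functions of the stages, from the last one backwards. -/
theorem exists_valueFunctions : ∃ V : Fin (N + 1) → RVec d → ℝ,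
    V (Fin.last N) = quadForm G.QT ∧ (∀ k, QuadLip (V k)) ∧ ∀ k : Fin N, ∀ ε > 0,
      (∃ κ : Kernel (RVec d) (RVec d₁),
        ∀ x, κ x ∈ momentBall (RVec d₁) (G.γ₁ ^ 2 * ‖x‖ ^ 2) ∧
        ∀ ν ∈ momentBall (RVec d₂) (G.γ₂ ^ 2 * ‖x‖ ^ 2),
          ∫ w, G.stagePayoff π k (V k.succ) (x, w) ∂((κ x).prod ν) ≤ V k.castSucc x + ε) ∧
      ∃ κ : Kernel (RVec d) (RVec d₂),
        ∀ x, κ x ∈ momentBall (RVec d₂) (G.γ₂ ^ 2 * ‖x‖ ^ 2) ∧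
        ∀ μ ∈ momentBall (RVec d₁) (G.γ₁ ^ 2 * ‖x‖ ^ 2),
          V k.castSucc x - ε ≤ ∫ w, G.stagePayoff π k (V k.succ) (x, w) ∂(μ.prod (κ x)) := by
  choose S hS hS' using fun (k : Fin N) (f : {f : RVec d → ℝ // QuadLip f}) =>
    (G.quadLip_stagePayoff π k f.2).exists_stage_value (sq_nonneg G.γ₁) (sq_nonneg G.γ₂)
  -- The recursion carries the regularity proof with the function, because the next stage value
  -- exists only for such payoffs.
  let W : Fin (N + 1) → {f : RVec d → ℝ // QuadLip f} :=
    Fin.reverseInduction (motive := fun _ => {f : RVec d → ℝ // QuadLip f})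
      ⟨_, quadLip_quadForm G.QT⟩ fun k f => ⟨S k f, hS k f⟩
  refine ⟨fun k => (W k).1, ?_, fun k => (W k).2, fun k => ?_⟩
  · simp [W]
  · have : (W k.castSucc).1 = S k (W k.succ) := by simp [W]
    simp only [this]
    exact hS' k (W k.succ)

/-- The value is `V 0 x₀`. Stagewise near-optimal kernels are admissible, since the moment-ball
radius is exactly the energy bound, and telescoping adds the losses. -/
theorem exists_value : ∃ V : ℝ, ∀ ε > 0,
    (∃ α : MixedStrategy d d₁ N G.γ₁, ∀ β : MixedStrategy d d₂ N G.γ₂,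
      G.J π x₀ α β ≤ V + ε) ∧
    ∃ β : MixedStrategy d d₂ N G.γ₂, ∀ α : MixedStrategy d d₁ N G.γ₁,
      V - ε ≤ G.J π x₀ α β := by
  obtain ⟨V, hlast, hV, hstep⟩ := G.exists_valueFunctions π
  have hN : (0 : ℝ) < N := Nat.cast_pos.2 π.pos
  refine ⟨V 0 x₀, fun ε hε => ?_⟩
  -- Each of the `N ≥ 1` stages is allotted an equal share of `ε`.
  choose κ hκ using fun k => (hstep k (ε / N) (by positivity)).1
  choose ρ hρ using fun k => (hstep k (ε / N) (by positivity)).2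
  have hεN : V 0 x₀ + (Fin.last N : ℕ) * (ε / N) = V 0 x₀ + ε := by
    rw [Fin.val_last]
    field_simp
  have hεN' : V 0 x₀ - (Fin.last N : ℕ) * (ε / N) = V 0 x₀ - ε := by
    rw [Fin.val_last]
    field_simp
  constructor
  · let α : MixedStrategy d d₁ N G.γ₁ :=
      ⟨κ, fun k => ⟨fun x => (hκ k x).1.1⟩, fun k x => (hκ k x).1.2⟩
    refine ⟨α, fun β => ?_⟩
    have h : ∀ k : Fin (N + 1), ∫ ω, G.costTo π x₀ k (V k) ω ∂(G.lawUpTo π x₀ α β k) ≤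
        V 0 x₀ + (k : ℕ) * (ε / N) := fun k => by
      induction k using Fin.induction with
      | zero => rw [G.integral_costTo_zero π x₀ α β _ (hV 0)]; simp
      | succ k ih =>
        refine (G.integral_costTo_succ_le π x₀ α β k (hV _) (hV k.castSucc) fun x =>
          (hκ k x).2 _ (kernel_mem_momentBall β k x)).trans ?_
        rw [Fin.val_castSucc] at ih
        rw [Fin.val_succ]
        push_cast
        linarith
    rw [J_eq, ← hlast]
    exact (h (Fin.last N)).trans_eq hεN
  · let β : MixedStrategy d d₂ N G.γ₂ :=
      ⟨ρ, fun k => ⟨fun x => (hρ k x).1.1⟩, fun k x => (hρ k x).1.2⟩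
    refine ⟨β, fun α => ?_⟩
    have h : ∀ k : Fin (N + 1), V 0 x₀ - (k : ℕ) * (ε / N) ≤
        ∫ ω, G.costTo π x₀ k (V k) ω ∂(G.lawUpTo π x₀ α β k) := fun k => by
      induction k using Fin.induction with
      | zero => rw [G.integral_costTo_zero π x₀ α β _ (hV 0)]; simp
      | succ k ih =>
        refine le_trans ?_ (G.le_integral_costTo_succ π x₀ α β k (hV _) (hV k.castSucc) fun x =>
          (hρ k x).2 _ (kernel_mem_momentBall α k x))
        rw [Fin.val_castSucc] at ih
        rw [Fin.val_succ]
        push_cast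
        linarith
    rw [J_eq, ← hlast]
    exact hεN'.symm.trans_le (h (Fin.last N))

/-- The guarantees give `upperValue ≤ V ≤ lowerValue`, and weak duality closes the chain. -/
theorem exists_upperValue_eq_lowerValue :
    ∃ V : ℝ, G.upperValue π x₀ = (V : EReal) ∧ G.lowerValue π x₀ = (V : EReal) := by
  obtain ⟨V, hV⟩ := G.exists_value π x₀
  have hle : G.lowerValue π x₀ ≤ G.upperValue π x₀ :=
    iSup_iInf_le_iInf_iSup fun (β : MixedStrategy d d₂ N G.γ₂) (α : MixedStrategy d d₁ N G.γ₁) =>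
      (G.J π x₀ α β : EReal)
  have hup : G.upperValue π x₀ ≤ V := by
    refine EReal.le_of_forall_lt_iff_le.1 fun c hc => ?_
    obtain ⟨α, hα⟩ := (hV (c - V) (sub_pos.2 (EReal.coe_lt_coe_iff.1 hc))).1
    refine iInf_le_of_le α (iSup_le fun β => EReal.coe_le_coe_iff.2 ?_)
    linarith [hα β]
  have hlow : (V : EReal) ≤ G.lowerValue π x₀ := by
    refine EReal.ge_of_forall_gt_iff_ge.1 fun c hc => ?_
    obtain ⟨β, hβ⟩ := (hV (V - c) (sub_pos.2 (EReal.coe_lt_coe_iff.1 hc))).2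
    refine le_iSup_of_le β (le_iInf fun α => EReal.coe_le_coe_iff.2 ?_)
    linarith [hβ α]
  exact ⟨V, le_antisymm hup (hlow.trans hle), le_antisymm (hle.trans hup) hlow⟩

end Law

end LQGame

theorem mainTheorem5 {d d₁ d₂ N : ℕ} {t₀ T : ℝ} (G : LQGame d d₁ d₂) (hG : G.Standing)
    (π : SamplingPartition t₀ T N) (x₀ : RVec d) :
    (∀ (α : MixedStrategy d d₁ N G.γ₁) (β : MixedStrategy d d₂ N G.γ₂),
      IsProbabilityMeasure (G.law π x₀ α β) ∧
        Integrable (G.cost π x₀) (G.law π x₀ α β)) ∧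
    ∃! V : ℝ, G.upperValue π x₀ = (V : EReal) ∧ G.lowerValue π x₀ = (V : EReal) := by
  refine ⟨fun α β => ⟨G.isProbabilityMeasure_lawUpTo π x₀ α β _, ?_⟩, ?_⟩
  · rw [funext (G.cost_eq π x₀)]
    exact G.integrable_costTo π x₀ α β (Fin.last N) (quadLip_quadForm G.QT)
  · obtain ⟨V, hu, hl⟩ := G.exists_upperValue_eq_lowerValue π x₀
    exact ⟨V, ⟨hu, hl⟩, fun V' hV' => EReal.coe_eq_coe_iff.1 (hV'.1.symm.trans hu)⟩
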